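/- All monoids are commutative; $\mathrm{Mon}$ is the category of monoids. We write monoids multiplicatively, and $P^*$ is the group of units of $P$. \emph{Flatness.} A module over a monoid $Q$ is a set with an action of $Q$. A $Q$-module $M$ is free if there is a subset $S \subseteq M$ such that every $m \in M$ is $m = q \cdot s$ for a unique pair $(q,s) \in Q \times S$, and flat if it is a filtered direct limit of free $Q$-modules. A monoid homomorphism $h : Q \to P$ is flat if $P$, with the action $q \cdot p = h(q)p$, is a flat $Q$-module; it is local if $h^{-1}(P^*) = Q^*$. \emph{Fans.} A locally monoidal space is a topological space $X$ with a sheaf of monoids $\mathcal{M}_X$; a morphism $f : X \to Y$ is a continuous map together with a map of sheaves of monoids $f^{-1}\mathcal{M}_Y \to \mathcal{M}_X$ whose stalk maps $f_x : \mathcal{M}_{Y,f(x)} \to \mathcal{M}_{X,x}$ are all local. A face of a monoid $P$ is a submonoid $F$ such that $ab \in F$ implies $a, b \in F$. $\operatorname{Spec} P$ is the locally monoidal space whose points are the faces of $P$, whose topology has the basic open sets $U_p = \{F : p \in F\}$ for $p \in P$, and whose structure sheaf $\mathcal{M}_P$ assigns to an open $U$ the families in $\prod_{F \in U} F^{-1}P$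 that are locally given by a fraction $a/b$ (so $\mathcal{M}_P(U_p) = P[p^{-1}]$ and $\mathcal{M}_{P,F} = F^{-1}P$). A homomorphism $h : Q \to P$ induces $\operatorname{Spec} h : \operatorname{Spec} P \to \operatorname{Spec} Q$, $F \mapsto h^{-1}(F)$. A locally finite type fan is a locally monoidal space covered by open subspaces isomorphic to $\operatorname{Spec} P$ with $P$ a finitely generated monoid; locally finite type fans form a full subcategory of locally monoidal spaces. A morphism $f : X \to Y$ of locally monoidal spaces is a flat cover if it is surjective and $f_x$ is flat for every $x \in X$. A homomorphism $h$ of monoids is faithfully flat if $\operatorname{Spec} h$ is a flat cover. \emph{Descent.} A morphism $p : X \to Y$ of a category $\mathcal{C}$ is an effective descent morphism if the fiber product $X \times_Y X$ exists and $$\operatorname{Hom}(Y,Z) \xrightarrow{\;p^*\;} \operatorname{Hom}(X,Z) \rightrightarrows \operatorname{Hom}(X \times_Y X, Z)$$ (the parallel arrows being $\pi_1^*, \pi_2^*$) is an equalizer diagram of sets for every object $Z$ of $\mathcal{C}$. It is a universal effective descent morphism if for every $Y' \to Y$ the fiber product $X \times_Y Y'$ exists and the projection $X \times_Y Y' \to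 Y'$ is an effective descent morphism. \textbf{Theorem.} (1) If $h : Q \to P$ is a faithfully flat map of monoids, then $h$, viewed as a morphism $P \to Q$ of $\mathrm{Mon}^{\mathrm{op}}$, is a universal effective descent morphism in $\mathrm{Mon}^{\mathrm{op}}$. (2) If $p : X \to Y$ is a flat cover of locally finite type fans, then $p$ is a universal effective descent morphism in the category of locally finite type fans. -/

import Mathlib

/-!
Monoids are commutative monoids; they are written multiplicatively here.
-/

open CategoryTheory CategoryTheory.Limits TopologicalSpace Opposite AlgebraicGeometry

universe v w u

noncomputable section

namespace Fans

/-! ## The category of commutative monoids is cocomplete -/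

/-- The largest commutative quotient of a monoid. -/
abbrev CommQuotient (M : MonCat.{u}) : Type u :=
  (conGen (fun x y : M => ∃ a b : M, x = a * b ∧ y = b * a)).Quotient

instance (M : MonCat.{u}) : CommMonoid (CommQuotient M) where
  mul_comm x y := by
    induction x using Con.induction_on with | _ a
    induction y using Con.induction_on with | _ b
    exact (Con.eq _).2 (ConGen.Rel.of _ _ ⟨a, b, rfl, rfl⟩)

/-- The universal property of the largest commutative quotient. -/
def commQuotientHomEquiv (M : MonCat.{u}) (N : CommMonCat.{u}) :
    (CommMonCat.of (CommQuotient M) ⟶ N) ≃ (M ⟶ (forget₂ CommMonCat MonCat).obj N) where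
  toFun f := MonCat.ofHom (f.hom.comp (Con.mk' _))
  invFun g := CommMonCat.ofHom (Con.lift _ g.hom (Con.conGen_le.2 (fun x y h => by
    obtain ⟨a, b, rfl, rfl⟩ := h
    change g.hom (a * b) = g.hom (b * a)
    rw [map_mul, map_mul]
    exact mul_comm (G := N) _ _)))
  left_inv f := by
    refine CommMonCat.hom_ext (MonoidHom.ext fun x => ?_)
    induction x using Con.induction_on with | _ a
    rfl
  right_inv g := by
    ext x
    rfl

/-- Commutative monoids form a reflective subcategory of all monoids. -/
instance : Reflective (forget₂ CommMonCat.{u} MonCat.{u}) where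
  L := Adjunction.leftAdjointOfEquiv commQuotientHomEquiv (fun _ _ _ _ _ => rfl)
  adj := Adjunction.adjunctionOfEquivLeft commQuotientHomEquiv (fun _ _ _ _ _ => rfl)

instance : HasColimits CommMonCat.{u} :=
  hasColimits_of_reflective (forget₂ CommMonCat.{u} MonCat.{u})

/-! ## Modules over a monoid and flatness

The category of modules (sets with an action) over a monoid `Q` is `Action (Type u) Q`. -/

section Modules

variable {Q P : Type u} [CommMonoid Q] [CommMonoid P]

/-- A `Q`-module is free if it has a basis `S`: every element is uniquely of the form `q • s`. -/
def IsFreeModule (M : Action (Type u) Q) : Prop :=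
  ∃ S : Set M.V, Function.Bijective (fun x : Q × S => M.ρ x.1 (x.2 : M.V))

/-- A `Q`-module is flat if it is a filtered colimit of free `Q`-modules. -/
def IsFlatModule (M : Action (Type u) Q) : Prop :=
  ∃ (J : Type u) (_ : SmallCategory J) (_ : IsFiltered J) (D : J ⥤ Action (Type u) Q)
    (c : Cocone D), Nonempty (IsColimit c) ∧ Nonempty (c.pt ≅ M) ∧ ∀ j, IsFreeModule (D.obj j)

/-- The target of a monoid homomorphism `h : Q →* P`, as a `Q`-module. -/
def moduleOfHom (h : Q →* P) : Action (Type u) Q where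
  V := P
  ρ :=
    { toFun := fun q => TypeCat.ofHom (fun p : P => h q * p)
      map_one' := by
        refine ConcreteCategory.hom_ext _ _ (fun p => ?_)
        change h 1 * p = p
        rw [map_one, one_mul]
      map_mul' := fun a b => by
        refine ConcreteCategory.hom_ext _ _ (fun p => ?_)
        change h (a * b) * p = h a * (h b * p)
        rw [map_mul, mul_assoc] }

/-- A monoid homomorphism is flat if its target is a flat module over its source. -/
def IsFlatHom (h : Q →* P) : Prop := IsFlatModule (moduleOfHom h)

end Modules

/-! ## Locally monoidal spaces -/

/-- The morphisms of monoidal spaces (topological spaces with a sheaf of monoids) all of whose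
stalk maps are local homomorphisms. -/
def localHoms : MorphismProperty (SheafedSpace CommMonCat.{u}) :=
  fun X _ f => ∀ x : X, IsLocalHom (f.hom.stalkMap x).hom

instance : localHoms.{u}.IsMultiplicative where
  id_mem X x := by
    have h : ((𝟙 X : X ⟶ X).hom.stalkMap x) = 𝟙 (X.presheaf.stalk x) :=
      PresheafedSpace.stalkMap.id X.toPresheafedSpace x
    refine ⟨fun a ha => ?_⟩
    rw [h] at ha
    exact ha
  comp_mem {X Y Z} f g hf hg x := by
    have h : (f ≫ g).hom.stalkMap x = g.hom.stalkMap (f.hom.base x) ≫ f.hom.stalkMap x :=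
      PresheafedSpace.stalkMap.comp f.hom g.hom x
    refine ⟨fun a ha => ?_⟩
    rw [h] at ha
    exact (hg (f.hom.base x)).map_nonunit _ ((hf x).map_nonunit _ ha)

/-- The category of locally monoidal spaces: its objects are all topological spaces with a sheaf
of monoids, its morphisms are those inducing local homomorphisms on stalks. -/
abbrev LMS : Type (u + 1) := WideSubcategory localHoms.{u}

/-- The restriction of a locally monoidal space to an open subset. -/
def LMS.restrict (X : LMS.{u}) (U : Opens X.obj) : LMS.{u} :=
  ⟨X.obj.restrict U.isOpenEmbedding⟩

/-- A morphism of locally monoidal spaces is flat if all its stalk maps are flat. -/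
def IsFlat {X Y : LMS.{u}} (f : X ⟶ Y) : Prop :=
  ∀ x : X.obj, IsFlatHom (f.hom.hom.stalkMap x).hom

/-- A flat cover is a flat morphism which is surjective on points. -/
def IsFlatCover {X Y : LMS.{u}} (f : X ⟶ Y) : Prop :=
  IsFlat f ∧ Function.Surjective f.hom.hom.base

/-! ## The spectrum of a monoid -/

section Spec

/-- A face of a monoid: a submonoid `F` such that `a * b ∈ F` implies `a ∈ F` and `b ∈ F`. -/
structure Face (P : Type u) [CommMonoid P] extends Submonoid P where
  mem_of_mul_mem : ∀ {a b : P}, a * b ∈ toSubmonoid → a ∈ toSubmonoid ∧ b ∈ toSubmonoid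

variable (P : Type u) [CommMonoid P]

/-- The basic open set of all faces containing `p`. -/
def basicOpenSet (p : P) : Set (Face P) := {F | p ∈ F.toSubmonoid}

/-- The Zariski topology on the set of faces. -/
instance : TopologicalSpace (Face P) :=
  TopologicalSpace.generateFrom (Set.range (basicOpenSet P))

/-- The topological space underlying `Spec P`. -/
def specTop : TopCat.{u} := TopCat.of (Face P)

variable {P}

theorem isOpen_basicOpenSet (p : P) : IsOpen (basicOpenSet P p) :=
  TopologicalSpace.isOpen_generateFrom_of_mem ⟨p, rfl⟩

/-- The basic open set of all faces containing `p`, as an open set. -/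
def basicOpen (p : P) : Opens (specTop P) := ⟨basicOpenSet P p, isOpen_basicOpenSet p⟩

/-- The localization of `P` at a face. -/
abbrev LocAt (F : specTop P) : Type u := Localization (Face.toSubmonoid (P := P) F)

/-- A family of elements of the localizations is given by one fraction `a / b` on `U`. -/
def IsFraction {U : Opens (specTop P)} (f : ∀ F : U, LocAt F.1) : Prop :=
  ∃ a b : P, ∀ F : U, ∃ hb : b ∈ Face.toSubmonoid (P := P) F.1, f F = Localization.mk a ⟨b, hb⟩

variable (P) in
/-- Being given by one fraction passes to smaller open sets. -/
def isFractionPrelocal : TopCat.PrelocalPredicate (fun F : specTop P => LocAt F) where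
  pred f := IsFraction f
  res := by
    rintro V U i f ⟨a, b, h⟩
    exact ⟨a, b, fun F => h (i F)⟩

variable (P) in
/-- Being given by a fraction locally. -/
def isLocallyFraction : TopCat.LocalPredicate (fun F : specTop P => LocAt F) :=
  (isFractionPrelocal P).sheafify

variable (P) in
/-- The sections of the structure sheaf of `Spec P` over `U`: families of elements of the
localizations `F⁻¹P`, `F ∈ U`, which locally are given by a fraction. -/
def sections (U : Opens (specTop P)) : Submonoid (∀ F : U, LocAt F.1) where
  carrier := {f | (isLocallyFraction P).pred f}
  one_mem' := fun F => ⟨U, F.2, 𝟙 _, 1, 1, fun G => ⟨one_mem _, (Localization.mk_one).symm⟩⟩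
  mul_mem' := by
    intro f g hf hg F
    obtain ⟨V, hV, i, a, b, h⟩ := hf F
    obtain ⟨W, hW, j, c, d, k⟩ := hg F
    refine ⟨V ⊓ W, ⟨hV, hW⟩, Opens.infLELeft _ _ ≫ i, a * c, b * d, fun G => ?_⟩
    obtain ⟨hb, h₁⟩ := h ⟨G.1, G.2.1⟩
    obtain ⟨hd, h₂⟩ := k ⟨G.1, G.2.2⟩
    exact ⟨mul_mem hb hd, (congrArg₂ (· * ·) h₁ h₂).trans (Localization.mk_mul _ _ _ _)⟩

variable (P) in
/-- The structure presheaf of `Spec P`. -/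
def structurePresheaf : TopCat.Presheaf CommMonCat.{u} (specTop P) where
  obj U := CommMonCat.of (sections P U.unop)
  map i := CommMonCat.ofHom
    { toFun := fun s => ⟨fun F => s.1 (i.unop F), (isLocallyFraction P).res i.unop s.1 s.2⟩
      map_one' := rfl
      map_mul' := fun _ _ => rfl }

theorem structurePresheaf_isSheaf : (structurePresheaf P).IsSheaf := by
  refine (TopCat.Presheaf.isSheaf_iff_isSheaf_comp (forget CommMonCat) _).mpr ?_
  refine TopCat.Presheaf.isSheaf_of_iso ?_ (TopCat.subpresheafToTypes.isSheaf (isLocallyFraction P))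
  exact NatIso.ofComponents (fun _ => Iso.refl _)

end Spec

/-- The locally monoidal space `Spec P`. -/
def Spec (P : CommMonCat.{u}) : LMS.{u} :=
  ⟨{ carrier := specTop P
     presheaf := structurePresheaf P
     IsSheaf := structurePresheaf_isSheaf }⟩

section SpecMap

variable {Q P : Type u} [CommMonoid Q] [CommMonoid P] (h : Q →* P)

/-- The preimage of a face under a monoid homomorphism. -/
def Face.comap (F : Face P) : Face Q where
  toSubmonoid := F.toSubmonoid.comap h
  mem_of_mul_mem := fun {a b} hab => F.mem_of_mul_mem (a := h a) (b := h b) (by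
    rw [← map_mul]; exact hab)

theorem continuous_comap : Continuous (Face.comap h) := by
  refine continuous_generateFrom_iff.2 ?_
  rintro _ ⟨q, rfl⟩
  exact isOpen_basicOpenSet (h q)

/-- The continuous map underlying `Spec h`. -/
def specTopMap : specTop P ⟶ specTop Q := TopCat.ofHom ⟨Face.comap h, continuous_comap h⟩

/-- The homomorphism of localizations induced by `h` at a face `F`. -/
def locMap (F : specTop P) : LocAt (specTopMap h F) →* LocAt F :=
  (Localization.monoidOf (Face.toSubmonoid (P := Q) (specTopMap h F))).map (g := h)
    (T := Face.toSubmonoid (P := P) F) (fun y => y.2)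
    (Localization.monoidOf (Face.toSubmonoid (P := P) F))

theorem locMap_mk (F : specTop P) (a b : Q)
    (hb : b ∈ Face.toSubmonoid (P := Q) (specTopMap h F)) :
    locMap h F (Localization.mk a ⟨b, hb⟩) = Localization.mk (h a) ⟨h b, hb⟩ := by
  rw [Localization.mk_eq_monoidOf_mk', Localization.mk_eq_monoidOf_mk']
  exact Submonoid.LocalizationMap.map_mk' _ _ _ _

/-- Pullback of sections of structure sheaves along `Spec h`. -/
def sectionsMap (U : Opens (specTop Q)) :
    sections Q U →* sections P ((Opens.map (specTopMap h)).obj U) where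
  toFun s := ⟨fun F => locMap h F.1 (s.1 ⟨specTopMap h F.1, F.2⟩), fun F => by
    obtain ⟨V, hV, i, a, b, w⟩ := s.2 ⟨specTopMap h F.1, F.2⟩
    refine ⟨(Opens.map (specTopMap h)).obj V, hV, (Opens.map (specTopMap h)).map i,
      h a, h b, fun G => ?_⟩
    obtain ⟨hb, w'⟩ := w ⟨specTopMap h G.1, G.2⟩
    exact ⟨hb, (congrArg (locMap h G.1) w').trans (locMap_mk h G.1 a b hb)⟩⟩
  map_one' := Subtype.ext (funext fun F => map_one (locMap h F.1))
  map_mul' s t := Subtype.ext (funext fun F => map_mul (locMap h F.1) _ _)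

end SpecMap

/-- `Spec h` as a morphism of monoidal spaces. -/
def specMapMS {Q P : CommMonCat.{u}} (h : Q ⟶ P) : (Spec P).obj ⟶ (Spec Q).obj :=
  InducedCategory.homMk
    { base := specTopMap h.hom
      c :=
        { app := fun U => CommMonCat.ofHom (sectionsMap h.hom U.unop)
          naturality := fun _ _ _ => rfl } }

/-- The value at `F` of a germ at `F`. -/
def evalStalk {P : CommMonCat.{u}} (F : specTop P) :
    (structurePresheaf P).stalk F ⟶ CommMonCat.of (LocAt F) :=
  colimit.desc _
    { pt := CommMonCat.of (LocAt F)
      ι :=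
        { app := fun U => CommMonCat.ofHom
            ((Pi.evalMonoidHom (fun G : U.unop.1 => LocAt G.1) ⟨F, U.unop.2⟩).comp
              (sections P U.unop.1).subtype)
          naturality := fun _ _ _ => rfl } }

theorem evalStalk_germ {P : CommMonCat.{u}} (F : specTop P) (U : Opens (specTop P)) (hF : F ∈ U)
    (s : sections P U) :
    (evalStalk F).hom (((structurePresheaf P).germ U F hF).hom s) = s.1 ⟨F, hF⟩ := by
  have := colimit.ι_desc (F := (OpenNhds.inclusion F).op ⋙ structurePresheaf P)
    { pt := CommMonCat.of (LocAt F)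
      ι :=
        { app := fun U => CommMonCat.ofHom
            ((Pi.evalMonoidHom (fun G : U.unop.1 => LocAt G.1) ⟨F, U.unop.2⟩).comp
              (sections P U.unop.1).subtype)
          naturality := fun _ _ _ => rfl } } (op ⟨U, hF⟩)
  exact congrArg (fun f => f.hom s) this

theorem isUnit_germ {P : CommMonCat.{u}} (F : specTop P) (U : Opens (specTop P)) (hF : F ∈ U)
    (s : sections P U) (a b : P) (ha : a ∈ Face.toSubmonoid (P := P) F)
    (hs : ∀ G : U, ∃ hb : b ∈ Face.toSubmonoid (P := P) G.1, s.1 G = Localization.mk a ⟨b, hb⟩) :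
    IsUnit (((structurePresheaf P).germ U F hF).hom s) := by
  let V : Opens (specTop P) := U ⊓ basicOpen a
  have hV : F ∈ V := ⟨hF, ha⟩
  let i : V ⟶ U := Opens.infLELeft _ _
  let t : sections P V := ⟨fun G => Localization.mk b ⟨a, G.2.2⟩,
    fun G => ⟨V, G.2, 𝟙 _, b, a, fun G' => ⟨G'.2.2, rfl⟩⟩⟩
  let s' : sections P V := ((structurePresheaf P).map i.op).hom s
  have hst : s' * t = 1 := by
    refine Subtype.ext (funext fun G => ?_)
    obtain ⟨hb, h⟩ := hs (i G)
    have h' : s'.1 G * t.1 G = 1 := by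
      change s.1 (i G) * Localization.mk b ⟨a, G.2.2⟩ = 1
      rw [h, Localization.mk_mul, ← Localization.mk_one, Localization.mk_eq_mk_iff,
        Localization.r_iff_exists]
      exact ⟨1, by simp [mul_comm]⟩
    exact h'
  have hres : ((structurePresheaf P).germ U F hF).hom s =
      ((structurePresheaf P).germ V F hV).hom s' :=
    (congrArg (fun f => f.hom s) ((structurePresheaf P).germ_res i F hV)).symm
  rw [hres]
  exact (IsUnit.of_mul_eq_one (M := sections P V) t hst).map ((structurePresheaf P).germ V F hV).hom

theorem isUnit_mk {P : Type u} [CommMonoid P] (F : Face P) (a : P) (b : F.toSubmonoid)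
    (hu : IsUnit (Localization.mk a b)) : a ∈ F.toSubmonoid := by
  obtain ⟨y, hy⟩ := isUnit_iff_exists_inv.1 hu
  induction y using Localization.induction_on with | _ y
  obtain ⟨c, d⟩ := y
  rw [Localization.mk_mul, ← Localization.mk_one, Localization.mk_eq_mk_iff,
    Localization.r_iff_exists] at hy
  obtain ⟨e, he⟩ := hy
  have : (e : P) * (a * c) ∈ F.toSubmonoid := by
    have h1 : (e : P) * (a * c) = (e : P) * ((b * d : F.toSubmonoid) : P) := by simpa using he
    rw [h1]
    exact mul_mem e.2 (b * d).2
  exact (F.mem_of_mul_mem (F.mem_of_mul_mem this).2).1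

theorem specMapMS_local {Q P : CommMonCat.{u}} (h : Q ⟶ P) : localHoms (specMapMS h) := by
  intro F
  refine ⟨fun z hz => ?_⟩
  obtain ⟨U, hF, s, rfl⟩ := (structurePresheaf Q).exists_germ_eq z
  obtain ⟨V, hV, i, a, b, w⟩ := s.2 ⟨_, hF⟩
  let s' : sections Q V := ((structurePresheaf Q).map i.op).hom s
  have hres : ((structurePresheaf Q).germ U _ hF).hom s =
      ((structurePresheaf Q).germ V _ hV).hom s' :=
    (congrArg (fun f => f.hom s) ((structurePresheaf Q).germ_res i _ hV)).symm
  have hmap : ((specMapMS h).hom.stalkMap F).hom (((structurePresheaf Q).germ V _ hV).hom s') =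
      ((structurePresheaf P).germ ((Opens.map (specTopMap h.hom)).obj V) F hV).hom
        (sectionsMap h.hom V s') :=
    congrArg (fun f => f.hom s') (PresheafedSpace.stalkMap_germ (specMapMS h).hom V F hV)
  have hz' : IsUnit (((structurePresheaf P).germ ((Opens.map (specTopMap h.hom)).obj V) F hV).hom
      (sectionsMap h.hom V s')) := by
    rw [← hmap, ← hres]
    exact hz
  have hu : IsUnit ((sectionsMap h.hom V s').1 ⟨F, hV⟩) :=
    (congrArg IsUnit (evalStalk_germ (P := P) F ((Opens.map (specTopMap h.hom)).obj V) hV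
      (sectionsMap h.hom V s'))).mp (hz'.map (evalStalk F).hom)
  obtain ⟨hb, hw⟩ := w ⟨_, hV⟩
  have hval : (sectionsMap h.hom V s').1 ⟨F, hV⟩ = Localization.mk (h.hom a) ⟨h.hom b, hb⟩ :=
    (congrArg (locMap h.hom F) hw).trans (locMap_mk h.hom F a b hb)
  rw [hval] at hu
  have ha := isUnit_mk F (h.hom a) ⟨h.hom b, hb⟩ hu
  have := isUnit_germ (specTopMap h.hom F) V hV s' a b ha w
  exact (congrArg IsUnit hres).mpr this

/-- `Spec h` as a morphism of locally monoidal spaces. -/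
def specMap {Q P : CommMonCat.{u}} (h : Q ⟶ P) : Spec P ⟶ Spec Q :=
  ⟨specMapMS h, specMapMS_local h⟩

/-- A monoid homomorphism `h` is faithfully flat if `Spec h` is a flat cover. -/
def IsFaithfullyFlat {Q P : CommMonCat.{u}} (h : Q ⟶ P) : Prop := IsFlatCover (specMap h)

/-! ## Locally finite type fans -/

/-- A locally finite type fan: a locally monoidal space covered by open subsets isomorphic to
spectra of finitely generated monoids. -/
def isLocallyFiniteTypeFan : ObjectProperty LMS.{u} :=
  fun X => ∀ x : X.obj, ∃ U : Opens X.obj, x ∈ U ∧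
    ∃ P : CommMonCat.{u}, Monoid.FG P ∧ Nonempty (X.restrict U ≅ Spec P)

/-- The category of locally finite type fans, a full subcategory of locally monoidal spaces. -/
abbrev LFTFan : Type (u + 1) := isLocallyFiniteTypeFan.{u}.FullSubcategory

/-! ## Effective descent morphisms -/

section Descent

variable {C : Type w} [Category.{v} C]

/-- A map `p : X ⟶ Y` is an effective descent morphism if the fiber product of `p` with itself
exists and `Hom(Y, Z) → Hom(X, Z) ⇉ Hom(X ×_Y X, Z)` is an equalizer diagram for all `Z`. -/
def IsEffectiveDescent {X Y : C} (p : X ⟶ Y) : Prop :=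
  HasPullback p p ∧
    ∀ (R : C) (π₁ π₂ : R ⟶ X), IsPullback π₁ π₂ p p →
      ∀ (Z : C) (f : X ⟶ Z), π₁ ≫ f = π₂ ≫ f → ∃! g : Y ⟶ Z, p ≫ g = f

/-- A map is a universal effective descent morphism if all its base changes exist and are
effective descent morphisms. -/
def IsUniversalEffectiveDescent {X Y : C} (p : X ⟶ Y) : Prop :=
  ∀ (Y' : C) (g : Y' ⟶ Y), HasPullback p g ∧
    ∀ (X' : C) (g' : X' ⟶ X) (p' : X' ⟶ Y'), IsPullback g' p' p g → IsEffectiveDescent p'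

end Descent

end Fans

end

noncomputable section

namespace Fans

/-! ## Flat local homomorphisms and amalgamated sums -/

section Algebra

variable {Q P P' : Type*} [CommMonoid Q] [CommMonoid P] [CommMonoid P']

/-! A flat module inherits two facts about equations from free modules: if `q • m = q' • m'`, then
`m` and `m'` are multiples `r • c`, `r' • c` of one element with `q * r = q' * r'`, and if moreover
`m = m'`, one may take `r = r'`. With locality, this is all that is used of flatness
(`IsFlatLocal`). It makes equality in an amalgamated sum explicit (`IsFlatLocal.exists_of_mk_eq`),
whence three consequences: stability under base change (`IsFlatLocal.inr`); `h : Q → P` is injective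
with image the equalizer of the two maps from `P` to the amalgamated sum of `P` with itself
(`IsFlatLocal.injective`, `IsFlatLocal.exists_preimage`); every face of `Q` is the preimage of a
face of `P` (`IsFlatLocal.exists_face`).

For monoids, a faithfully flat `h` is identified with the stalk map of `Spec h` at the face of
units, and surjectivity over the face of units of `Q` makes it local. Pushouts of monoids are
amalgamated sums, so the equalizer statement and base change give the claim.

For fans, the fiber product of locally monoidal spaces is the fiber product of topological spaces,
with the amalgamated sums of stalks as stalks (`Pb.isPullback`). Morphisms descend along an open
surjection with flat stalk maps: the map on points because the surjection is a quotient map, the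
stalk maps by the equalizer statement, and sections because images of open sets are open
(`IsOpenFlatCover.exists_comp_eq`). These properties survive base change. It remains to see that
fiber products of locally finite type fans are again such fans and that flat covers between them are
open. Both rest on charts: as faces of a finitely generated monoid are finitely generated, each
point has a smallest open neighborhood, which is the spectrum of its stalk. `IsChart` expresses this
through specializations and stalks only, so that it can be checked directly on a fiber product. -/

/-- The elementwise form of flatness, together with locality, of a homomorphism of monoids. -/
structure IsFlatLocal (h : Q →* P) : Prop where
  exists_factor : ∀ q q' p p', h q * p = h q' * p' →
    ∃ c r r', p = h r * c ∧ p' = h r' * c ∧ q * r = q' * r'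
  exists_equalize : ∀ q q' p, h q * p = h q' * p → ∃ c r, p = h r * c ∧ q * r = q' * r
  isUnit_of_map : ∀ q, IsUnit (h q) → IsUnit q

/-- Equalizing at `p = 1` gives `1 = h r * c`, so locality makes `r` a unit and it cancels. Flatness
alone is not enough: a localization is flat but may identify elements. -/
theorem IsFlatLocal.injective {h : Q →* P} (H : IsFlatLocal h) : Function.Injective h := by
  intro q q' e
  obtain ⟨c, r, h1, h2⟩ := H.exists_equalize q q' 1 (by rw [e])
  have hr : IsUnit r := H.isUnit_of_map r (IsUnit.of_mul_eq_one c h1.symm)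
  exact hr.mul_left_injective h2

/-- The congruence on `P × P'` defining the amalgamated sum. -/
def amalgCon (h : Q →* P) (k : Q →* P') : Con (P × P') :=
  conGen (fun x y => ∃ q, x = (h q, 1) ∧ y = (1, k q))

/-- The amalgamated sum of two monoids over a third one. -/
def Amalg (h : Q →* P) (k : Q →* P') : Type _ := (amalgCon h k).Quotient

namespace Amalg

variable (h : Q →* P) (k : Q →* P')

instance : CommMonoid (Amalg h k) := inferInstanceAs (CommMonoid (amalgCon h k).Quotient)

/-- The quotient map to the amalgamated sum. -/
def mk : P × P' →* Amalg h k := (amalgCon h k).mk'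

/-- The first inclusion. -/
def inl : P →* Amalg h k := (mk h k).comp (MonoidHom.inl P P')

/-- The second inclusion. -/
def inr : P' →* Amalg h k := (mk h k).comp (MonoidHom.inr P P')

theorem mk_surjective : Function.Surjective (mk h k) := (amalgCon h k).mk'_surjective

theorem mk_eq_iff {x y : P × P'} : mk h k x = mk h k y ↔ amalgCon h k x y := (amalgCon h k).eq

theorem inl_mul_inr (p : P) (p' : P') : inl h k p * inr h k p' = mk h k (p, p') := by
  simp [inl, inr, ← map_mul]

theorem exists_rep (z : Amalg h k) : ∃ p p', z = inl h k p * inr h k p' := by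
  obtain ⟨⟨p, p'⟩, rfl⟩ := mk_surjective h k z
  exact ⟨p, p', (inl_mul_inr h k p p').symm⟩

theorem condition (q : Q) : inl h k (h q) = inr h k (k q) :=
  (mk_eq_iff h k).2 (ConGen.Rel.of _ _ ⟨q, rfl, rfl⟩)

variable {h k}

/-- The universal property of the amalgamated sum. -/
def lift {R : Type*} [CommMonoid R] (a : P →* R) (b : P' →* R) (w : ∀ q, a (h q) = b (k q)) :
    Amalg h k →* R :=
  Con.lift _ (a.coprod b) (Con.conGen_le.2 (by
    rintro _ _ ⟨q, rfl, rfl⟩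
    simpa [Con.ker_rel] using w q))

theorem lift_mk {R : Type*} [CommMonoid R] (a : P →* R) (b : P' →* R)
    (w : ∀ q, a (h q) = b (k q)) (p : P) (p' : P') : lift a b w (mk h k (p, p')) = a p * b p' :=
  rfl

theorem lift_inl {R : Type*} [CommMonoid R] (a : P →* R) (b : P' →* R)
    (w : ∀ q, a (h q) = b (k q)) (p : P) : lift a b w (inl h k p) = a p :=
  (lift_mk a b w p 1).trans (by simp)

theorem lift_inr {R : Type*} [CommMonoid R] (a : P →* R) (b : P' →* R)
    (w : ∀ q, a (h q) = b (k q)) (p' : P') : lift a b w (inr h k p') = b p' :=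
  (lift_mk a b w 1 p').trans (by simp)

theorem hom_ext {R : Type*} [CommMonoid R] {a b : Amalg h k →* R}
    (h₁ : ∀ p, a (inl h k p) = b (inl h k p)) (h₂ : ∀ p, a (inr h k p) = b (inr h k p)) :
    a = b := by
  ext z
  obtain ⟨p, p', rfl⟩ := exists_rep h k z
  simp [h₁, h₂]

/-- A congruence on `P × P'` which identifies the two images of `Q` contains `amalgCon`. -/
theorem con_of_mk_eq (c : Con (P × P')) (hc : ∀ q, c (h q, 1) (1, k q)) {x y : P × P'}
    (e : mk h k x = mk h k y) : c x y := by
  have : amalgCon h k ≤ c := Con.conGen_le.2 (by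
    rintro _ _ ⟨q, rfl, rfl⟩
    exact hc q)
  exact this ((mk_eq_iff h k).1 e)

/-- Having the same status as a unit is a congruence on `P × P'`, and locality of both maps puts the
generators of `amalgCon` into it. This is what makes the projections of a fiber product local. -/
theorem isUnit_mk_iff (hh : ∀ q, IsUnit (h q) → IsUnit q) (hk : ∀ q, IsUnit (k q) → IsUnit q)
    (p : P) (p' : P') : IsUnit (mk h k (p, p')) ↔ IsUnit p ∧ IsUnit p' := by
  constructor
  · intro hu
    obtain ⟨z, hz⟩ := hu.exists_right_inv
    obtain ⟨⟨c, d⟩, rfl⟩ := mk_surjective h k z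
    let C : Con (P × P') :=
      { r := fun x y => IsUnit x ↔ IsUnit y
        iseqv := ⟨fun _ => Iff.rfl, fun e => e.symm, fun e e' => e.trans e'⟩
        mul' := fun e e' => by
          rw [IsUnit.mul_iff, IsUnit.mul_iff]
          exact and_congr e e' }
    have key : C ((p, p') * (c, d)) 1 := by
      refine con_of_mk_eq C (fun q => ?_) (by rw [map_mul, hz, map_one])
      change IsUnit (h q, (1 : P')) ↔ IsUnit ((1 : P), k q)
      rw [Prod.isUnit_iff, Prod.isUnit_iff]
      simp only [isUnit_one, and_true, true_and]
      exact ⟨fun e => (hh q e).map k, fun e => (hk q e).map h⟩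
    have h1 : IsUnit ((p, p') * (c, d)) := key.2 isUnit_one
    exact Prod.isUnit_iff.1 (isUnit_of_mul_isUnit_left h1)
  · intro hu
    exact (Prod.isUnit_iff.2 hu).map (mk h k)

theorem isUnit_inl_iff (hh : ∀ q, IsUnit (h q) → IsUnit q) (hk : ∀ q, IsUnit (k q) → IsUnit q)
    (p : P) : IsUnit (inl h k p) ↔ IsUnit p :=
  (isUnit_mk_iff hh hk p 1).trans (by simp)

theorem isUnit_inr_iff (hh : ∀ q, IsUnit (h q) → IsUnit q) (hk : ∀ q, IsUnit (k q) → IsUnit q)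
    (p : P') : IsUnit (inr h k p) ↔ IsUnit p :=
  (isUnit_mk_iff hh hk 1 p).trans (by simp)

end Amalg

variable {h : Q →* P} (H : IsFlatLocal h) (k : Q →* P')
include H

/-- Equality in the amalgamated sum, when one of the two maps is flat. -/
theorem IsFlatLocal.exists_of_mk_eq {p₁ p₂ : P} {n₁ n₂ : P'}
    (e : Amalg.mk h k (p₁, n₁) = Amalg.mk h k (p₂, n₂)) :
    ∃ c r s, p₁ = h r * c ∧ p₂ = h s * c ∧ k r * n₁ = k s * n₂ := by
  -- The relation in the conclusion is itself a congruence, so no chains of elementary moves are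
  -- needed. Flatness enters in transitivity: `exists_factor` refines the two factorizations of the
  -- middle component `y.1` to a common one.
  let C : Con (P × P') :=
    { r := fun x y => ∃ c r s, x.1 = h r * c ∧ y.1 = h s * c ∧ k r * x.2 = k s * y.2
      iseqv := by
        refine ⟨fun x => ⟨x.1, 1, 1, by simp, by simp, rfl⟩, ?_, ?_⟩
        · rintro x y ⟨c, r, s, h1, h2, h3⟩
          exact ⟨c, s, r, h2, h1, h3.symm⟩
        · rintro x y z ⟨a, r, r', h1, h2, h3⟩ ⟨b, s, s', h4, h5, h6⟩
          obtain ⟨c, t, t', h7, h8, h9⟩ := H.exists_factor r' s a b (h2.symm.trans h4)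
          refine ⟨c, r * t, s' * t', by rw [h1, h7, map_mul, mul_assoc],
            by rw [h5, h8, map_mul, mul_assoc], ?_⟩
          calc k (r * t) * x.2 = k t * (k r * x.2) := by
                rw [mul_comm r, map_mul, mul_assoc]
            _ = k (r' * t) * y.2 := by rw [h3, mul_comm r', map_mul, mul_assoc]
            _ = k t' * (k s * y.2) := by rw [h9, mul_comm s, map_mul, mul_assoc]
            _ = k (s' * t') * z.2 := by rw [h6, mul_comm s', map_mul, mul_assoc]
      mul' := by
        rintro x y z t ⟨a, r, r', h1, h2, h3⟩ ⟨b, s, s', h4, h5, h6⟩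
        refine ⟨a * b, r * s, r' * s', ?_, ?_, ?_⟩
        · rw [Prod.fst_mul, h1, h4, map_mul, mul_mul_mul_comm]
        · rw [Prod.fst_mul, h2, h5, map_mul, mul_mul_mul_comm]
        · rw [Prod.snd_mul, Prod.snd_mul, map_mul, map_mul, mul_mul_mul_comm, h3, h6,
            mul_mul_mul_comm] }
  exact Amalg.con_of_mk_eq C (fun q => ⟨1, q, 1, by simp, by simp, by simp⟩) e

/-- Flat local homomorphisms are stable under base change. -/
theorem IsFlatLocal.inr : IsFlatLocal (Amalg.inr h k) where
  exists_factor := by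
    intro q q' p p' e
    obtain ⟨m₁, n₁, rfl⟩ := Amalg.exists_rep h k p
    obtain ⟨m₂, n₂, rfl⟩ := Amalg.exists_rep h k p'
    -- Multiplication by `inr q` acts on the second component, so both sides become classes of pairs
    -- to which the description of equality applies.
    rw [mul_left_comm, ← map_mul, mul_left_comm, ← map_mul, Amalg.inl_mul_inr,
      Amalg.inl_mul_inr] at e
    obtain ⟨c, r, s, rfl, rfl, h3⟩ := H.exists_of_mk_eq k e
    refine ⟨Amalg.inl h k c, k r * n₁, k s * n₂, ?_, ?_, ?_⟩
    · rw [map_mul, map_mul, Amalg.condition, mul_right_comm]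
    · rw [map_mul, map_mul, Amalg.condition, mul_right_comm]
    · rw [mul_left_comm, h3, mul_left_comm]
  exists_equalize := by
    intro q q' p e
    obtain ⟨m, n, rfl⟩ := Amalg.exists_rep h k p
    rw [mul_left_comm, ← map_mul, mul_left_comm, ← map_mul, Amalg.inl_mul_inr,
      Amalg.inl_mul_inr] at e
    obtain ⟨c, r, s, h1, h2, h3⟩ := H.exists_of_mk_eq k e
    -- The same element is `h r * c` and `h s * c`; hence `r` and `s` agree after multiplication by
    -- some `t` with `h t` dividing `c`.
    obtain ⟨d, t, rfl, h5⟩ := H.exists_equalize r s c (h1.symm.trans h2)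
    refine ⟨Amalg.inl h k d, k (r * t) * n, ?_, ?_⟩
    · rw [h1, ← mul_assoc, ← map_mul h, map_mul (Amalg.inl h k), map_mul (Amalg.inr h k),
        Amalg.condition, mul_right_comm]
    · calc q * (k (r * t) * n) = k t * (k r * (q * n)) := by
            rw [mul_left_comm, mul_comm r, map_mul, mul_assoc]
        _ = k (s * t) * (q' * n) := by rw [h3, mul_comm s, map_mul, mul_assoc]
        _ = q' * (k (r * t) * n) := by rw [h5, mul_left_comm]
  isUnit_of_map := by
    intro q hq
    obtain ⟨z, hz⟩ := hq.exists_right_inv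
    obtain ⟨p, n, rfl⟩ := Amalg.exists_rep h k z
    rw [mul_left_comm, ← map_mul, Amalg.inl_mul_inr, ← map_one (Amalg.mk h k)] at hz
    obtain ⟨c, r, s, h1, h2, h3⟩ := H.exists_of_mk_eq k hz
    have hs : IsUnit s := H.isUnit_of_map s (IsUnit.of_mul_eq_one c h2.symm)
    have : IsUnit (k r * (q * n)) := by
      rw [h3]
      simpa using hs.map k
    exact isUnit_of_mul_isUnit_left (isUnit_of_mul_isUnit_right this)

omit k in
/-- The source of a flat local homomorphism is the equalizer of the two maps to the amalgamated
sum of the target with itself. -/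
theorem IsFlatLocal.exists_preimage {p : P} (e : Amalg.inl h h p = Amalg.inr h h p) :
    ∃ q, h q = p := by
  obtain ⟨c, r, s, h1, h2, h3⟩ := H.exists_of_mk_eq h (p₁ := p) (n₁ := 1) (p₂ := 1) (n₂ := p) e
  -- As `h s` divides `1`, `s` is a unit, and `h r = h s * p` can be solved for `p`.
  have hs : IsUnit s := H.isUnit_of_map s (IsUnit.of_mul_eq_one c h2.symm)
  obtain ⟨s, rfl⟩ := hs
  refine ⟨r * (s⁻¹ : Qˣ), ?_⟩
  rw [map_mul, ← mul_one (h r), h3, mul_comm (h s), mul_assoc, ← map_mul]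
  simp

omit k in
/-- The map on spectra induced by a flat local homomorphism is surjective. -/
theorem IsFlatLocal.exists_face (F : Submonoid Q)
    (hF : ∀ {a b : Q}, a * b ∈ F → a ∈ F ∧ b ∈ F) :
    ∃ G : Submonoid P, (∀ {a b : P}, a * b ∈ G → a ∈ G ∧ b ∈ G) ∧ ∀ q, h q ∈ G ↔ q ∈ F := by
  -- The face generated by `h(F)`: all divisors of elements of `h(F)`.
  refine ⟨{ carrier := {p | ∃ p', ∃ q ∈ F, p * p' = h q}
            one_mem' := ⟨1, 1, one_mem F, by simp⟩
            mul_mem' := ?_ }, ?_, fun q => ⟨?_, fun hq => ⟨1, q, hq, mul_one _⟩⟩⟩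
  · rintro a b ⟨a', q, hq, ha⟩ ⟨b', q', hq', hb⟩
    exact ⟨a' * b', q * q', mul_mem hq hq', by rw [mul_mul_mul_comm, ha, hb, map_mul]⟩
  · rintro a b ⟨c, q, hq, hc⟩
    exact ⟨⟨b * c, q, hq, by rw [← mul_assoc, hc]⟩,
      ⟨a * c, q, hq, by rw [← mul_assoc, mul_comm b, hc]⟩⟩
  · rintro ⟨p', f, hf, e⟩
    -- Choosing `1` as the second element forces `s` to be a unit, so `q` divides the element `f *
    -- s` of `F`.
    obtain ⟨c, r, s, h1, h2, h3⟩ := H.exists_factor q f p' 1 (by rw [e, mul_one])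
    have hs : IsUnit s := H.isUnit_of_map s (IsUnit.of_mul_eq_one c h2.symm)
    obtain ⟨t, ht⟩ := hs.exists_right_inv
    have hsF : s ∈ F := (hF (a := s) (b := t) (by rw [ht]; exact one_mem F)).1
    have : q * r ∈ F := by rw [h3]; exact mul_mem hf hsF
    exact (hF this).1

end Algebra

/-! ## Flat modules -/

section Flat

variable {Q P : Type u} [CommMonoid Q] [CommMonoid P]

/-- Both sides of the equation are multiples of the same basis element, which serves as `c`; the
identity in `Q` is uniqueness of coordinates. -/
theorem IsFreeModule.exists_factor {M : Action (Type u) Q} (hM : IsFreeModule M) {q q' : Q}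
    {m m' : M.V} (e : M.ρ q m = M.ρ q' m') :
    ∃ c r r', m = M.ρ r c ∧ m' = M.ρ r' c ∧ q * r = q' * r' := by
  obtain ⟨S, hS⟩ := hM
  obtain ⟨⟨r, s⟩, rfl⟩ := hS.2 m
  obtain ⟨⟨r', s'⟩, rfl⟩ := hS.2 m'
  have hmul : ∀ (a b : Q) (x : M.V), M.ρ a (M.ρ b x) = M.ρ (a * b) x := fun a b x => by
    rw [map_mul]; rfl
  rw [hmul, hmul] at e
  have := @hS.1 (q * r, s) (q' * r', s') e
  simp only [Prod.mk.injEq] at this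
  obtain ⟨h1, rfl⟩ := this
  exact ⟨s, r, r', rfl, rfl, h1⟩

theorem IsFreeModule.exists_equalize {M : Action (Type u) Q} (hM : IsFreeModule M) {q q' : Q}
    {m : M.V} (e : M.ρ q m = M.ρ q' m) : ∃ c r, m = M.ρ r c ∧ q * r = q' * r := by
  obtain ⟨S, hS⟩ := hM
  obtain ⟨⟨r, s⟩, rfl⟩ := hS.2 m
  have hmul : ∀ (a b : Q) (x : M.V), M.ρ a (M.ρ b x) = M.ρ (a * b) x := fun a b x => by
    rw [map_mul]; rfl
  rw [hmul, hmul] at e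
  have := @hS.1 (q * r, s) (q' * r, s) e
  simp only [Prod.mk.injEq, and_true] at this
  exact ⟨s, r, rfl, this⟩

/-- An equation in a flat module holds already in a free module mapping to it. -/
theorem IsFlatModule.exists_free {M : Action (Type u) Q} (hM : IsFlatModule M) {q q' : Q}
    {m m' : M.V} (h : M.ρ q m = M.ρ q' m') :
    ∃ (N : Action (Type u) Q) (_ : IsFreeModule N) (φ : N ⟶ M) (n n' : N.V),
      φ.hom n = m ∧ φ.hom n' = m' ∧ N.ρ q n = N.ρ q' n' ∧ (m = m' → n = n') := by
  obtain ⟨J, _, _, D, c, ⟨hc⟩, ⟨e⟩, hD⟩ := hM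
  have hc' : IsColimit ((Action.forget (Type u) Q).mapCocone c) := isColimitOfPreserves _ hc
  let φ : ∀ j, D.obj j ⟶ M := fun j => c.ι.app j ≫ e.hom
  have hequiv : ∀ {A B : Action (Type u) Q} (f : A ⟶ B) (q : Q) (x : A.V),
      f.hom (A.ρ q x) = B.ρ q (f.hom x) := fun f q x => congrArg (fun g => g x) (f.comm q)
  have hw : ∀ {i j : J} (f : i ⟶ j) (x : (D.obj i).V), (φ j).hom ((D.map f).hom x) = (φ i).hom x :=
    fun f x => congrArg (fun g => e.hom.hom (g.hom x)) (c.w f)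
  have hsurj : ∀ m : M.V, ∃ j, ∃ n : (D.obj j).V, (φ j).hom n = m := by
    intro m
    obtain ⟨j, n, hn⟩ := Types.jointly_surjective _ hc' (e.inv.hom m)
    refine ⟨j, n, ?_⟩
    have : (c.ι.app j).hom n = e.inv.hom m := hn
    change e.hom.hom ((c.ι.app j).hom n) = m
    rw [this]
    exact congrArg (fun f : M ⟶ M => f.hom m) e.inv_hom_id
  have heq : ∀ {k : J} (x y : (D.obj k).V), (φ k).hom x = (φ k).hom y →
      ∃ (l : J) (t : k ⟶ l), (D.map t).hom x = (D.map t).hom y := by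
    intro k x y h1
    have h2 : ∀ x : c.pt.V, e.inv.hom (e.hom.hom x) = x := fun x =>
      congrArg (fun f : c.pt ⟶ c.pt => f.hom x) e.hom_inv_id
    have hab : (c.ι.app k).hom x = (c.ι.app k).hom y :=
      (h2 _).symm.trans ((congrArg (fun x => e.inv.hom x) h1).trans (h2 _))
    obtain ⟨l, f, g, hfg⟩ := (Types.FilteredColimit.isColimit_eq_iff _ hc').1 hab
    refine ⟨_, f ≫ IsFiltered.coeqHom f g, ?_⟩
    have h5 : ∀ x, (D.map (f ≫ IsFiltered.coeqHom f g)).hom x =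
        (D.map (IsFiltered.coeqHom f g)).hom ((D.map f).hom x) := fun x => by
      rw [D.map_comp]; rfl
    have h6 : ∀ x, (D.map (f ≫ IsFiltered.coeqHom f g)).hom x =
        (D.map (IsFiltered.coeqHom f g)).hom ((D.map g).hom x) := fun x => by
      rw [IsFiltered.coeq_condition f g, D.map_comp]; rfl
    rw [h5, h6 y]
    exact congrArg (fun x => (D.map (IsFiltered.coeqHom f g)).hom x) hfg
  obtain ⟨j, n, hn⟩ := hsurj m
  obtain ⟨j', n', hn'⟩ := hsurj m'
  obtain ⟨a, ha⟩ : ∃ a, a = (D.map (IsFiltered.leftToMax j j')).hom n := ⟨_, rfl⟩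
  obtain ⟨b, hb⟩ : ∃ b, b = (D.map (IsFiltered.rightToMax j j')).hom n' := ⟨_, rfl⟩
  have ha' : (φ _).hom a = m := by rw [ha, hw, hn]
  have hb' : (φ _).hom b = m' := by rw [hb, hw, hn']
  obtain ⟨l, t, hl⟩ := heq ((D.obj _).ρ q a) ((D.obj _).ρ q' b) (by
    rw [hequiv, hequiv, ha', hb', h])
  rw [hequiv, hequiv] at hl
  -- If `m = m'`, the two lifts may still differ at stage `l`; a further stage identifies them. This
  -- lets one lemma serve both `exists_factor` and `exists_equalize`.
  by_cases hm : m = m'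
  · obtain ⟨l', t', hl'⟩ := heq ((D.map t).hom a) ((D.map t).hom b) (by
      rw [hw, hw, ha', hb', hm])
    refine ⟨D.obj l', hD _, φ l', (D.map t').hom ((D.map t).hom a),
      (D.map t').hom ((D.map t).hom b), by rw [hw, hw, ha'], by rw [hw, hw, hb'], ?_,
      fun _ => hl'⟩
    rw [← hequiv (D.map t'), ← hequiv (D.map t')]
    exact congrArg (fun x => (D.map t').hom x) hl
  · exact ⟨D.obj l, hD _, φ l, (D.map t).hom a, (D.map t).hom b, by rw [hw, ha'],
      by rw [hw, hb'], hl, fun h => absurd h hm⟩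

theorem IsFlatHom.isFlatLocal {h : Q →* P} (hh : IsFlatHom h)
    (hl : ∀ q, IsUnit (h q) → IsUnit q) : IsFlatLocal h where
  exists_factor q q' p p' e := by
    obtain ⟨N, hN, φ, n, n', hn, hn', e', -⟩ := hh.exists_free (m := p) (m' := p') e
    obtain ⟨c, r, r', h1, h2, h3⟩ := hN.exists_factor e'
    have hequiv : ∀ (q : Q) (x : N.V), φ.hom (N.ρ q x) = (moduleOfHom h).ρ q (φ.hom x) :=
      fun q x => congrArg (fun g => g x) (φ.comm q)
    refine ⟨φ.hom c, r, r', ?_, ?_, h3⟩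
    · exact hn.symm.trans (by rw [h1, hequiv]; rfl)
    · exact hn'.symm.trans (by rw [h2, hequiv]; rfl)
  exists_equalize q q' p e := by
    obtain ⟨N, hN, φ, n, n', hn, -, e', hnn⟩ := hh.exists_free (m := p) (m' := p) e
    obtain rfl := hnn rfl
    obtain ⟨c, r, h1, h2⟩ := hN.exists_equalize e'
    have hequiv : ∀ (q : Q) (x : N.V), φ.hom (N.ρ q x) = (moduleOfHom h).ρ q (φ.hom x) :=
      fun q x => congrArg (fun g => g x) (φ.comm q)
    exact ⟨φ.hom c, r, hn.symm.trans (by rw [h1, hequiv]; rfl), h2⟩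
  isUnit_of_map := hl

end Flat

/-! ## Germs and stalk maps of locally monoidal spaces -/

namespace LMS

section Basic

variable (X : LMS.{u})

/-- The stalk of the structure sheaf at a point. -/
abbrev stalk (x : X.obj) : CommMonCat.{u} := X.obj.presheaf.stalk x

/-- The sections of the structure sheaf over an open set. -/
abbrev Sec (U : Opens X.obj) : CommMonCat.{u} := X.obj.presheaf.obj (op U)

/-- The germ of a section at a point. -/
def germ (U : Opens X.obj) (x : X.obj) (hx : x ∈ U) : X.Sec U →* X.stalk x :=
  (X.obj.presheaf.germ U x hx).hom

/-- The restriction of sections. -/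
def res {U V : Opens X.obj} (h : V ≤ U) : X.Sec U →* X.Sec V :=
  (X.obj.presheaf.map (homOfLE h).op).hom

theorem germ_res {U V : Opens X.obj} (h : V ≤ U) (x : X.obj) (hx : x ∈ V) (s : X.Sec U) :
    X.germ V x hx (X.res h s) = X.germ U x (h hx) s :=
  congrArg (fun f => f.hom s) (X.obj.presheaf.germ_res (homOfLE h) x hx)

theorem exists_germ_eq {x : X.obj} (a : X.stalk x) :
    ∃ (U : Opens X.obj) (hx : x ∈ U) (s : X.Sec U), X.germ U x hx s = a :=
  X.obj.presheaf.exists_germ_eq a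

theorem exists_res_eq {U V : Opens X.obj} {x : X.obj} (hU : x ∈ U) (hV : x ∈ V) {s : X.Sec U}
    {t : X.Sec V} (e : X.germ U x hU s = X.germ V x hV t) :
    ∃ (W : Opens X.obj) (_ : x ∈ W) (h₁ : W ≤ U) (h₂ : W ≤ V), X.res h₁ s = X.res h₂ t := by
  obtain ⟨W, hW, i, j, h⟩ := X.obj.presheaf.germ_eq x hU hV s t e
  exact ⟨W, hW, i.le, j.le, h⟩

/-- Sections with the same germ at a point have the same germs at nearby points. -/
theorem exists_germ_eq_near {U V : Opens X.obj} {x : X.obj} (hU : x ∈ U) (hV : x ∈ V)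
    {s : X.Sec U} {t : X.Sec V} (e : X.germ U x hU s = X.germ V x hV t) :
    ∃ (W : Opens X.obj) (_ : x ∈ W) (h₁ : W ≤ U) (h₂ : W ≤ V),
      ∀ y (hy : y ∈ W), X.germ U y (h₁ hy) s = X.germ V y (h₂ hy) t := by
  obtain ⟨W, hW, h₁, h₂, h⟩ := X.exists_res_eq hU hV e
  refine ⟨W, hW, h₁, h₂, fun y hy => ?_⟩
  rw [← X.germ_res h₁ y hy, ← X.germ_res h₂ y hy, h]

theorem sec_ext {U : Opens X.obj} {s t : X.Sec U}
    (h : ∀ x hx, X.germ U x hx s = X.germ U x hx t) : s = t :=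
  TopCat.Presheaf.section_ext X.obj.sheaf U s t h

/-- A family of germs is a section if it is so locally. -/
theorem exists_sec (U : Opens X.obj) (σ : ∀ x ∈ U, X.stalk x)
    (h : ∀ x ∈ U, ∃ (V : Opens X.obj) (_ : x ∈ V) (s : X.Sec V),
      ∀ y (hV : y ∈ V) (hU : y ∈ U), X.germ V y hV s = σ y hU) :
    ∃ s : X.Sec U, ∀ x hx, X.germ U x hx s = σ x hx := by
  choose V hV s hs using h
  let W : U → Opens X.obj := fun x => V x.1 x.2 ⊓ U
  obtain ⟨t, ht, -⟩ := X.obj.sheaf.existsUnique_gluing' W U (fun x => homOfLE inf_le_right)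
    (fun x hx => Opens.mem_iSup.2 ⟨⟨x, hx⟩, hV x hx, hx⟩)
    (fun x => X.res inf_le_left (s x.1 x.2)) (by
      intro i j
      refine X.sec_ext fun y hy => ?_
      have h1 := X.germ_res (inf_le_left : W i ⊓ W j ≤ W i) y hy (X.res inf_le_left (s i.1 i.2))
      have h2 := X.germ_res (inf_le_right : W i ⊓ W j ≤ W j) y hy (X.res inf_le_left (s j.1 j.2))
      refine h1.trans (Eq.trans ?_ h2.symm)
      rw [germ_res, germ_res, hs _ _ y hy.1.1 hy.1.2, hs _ _ y hy.2.1 hy.1.2])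
  refine ⟨t, fun x hx => ?_⟩
  have h1 : X.res (inf_le_right : W ⟨x, hx⟩ ≤ U) t = X.res inf_le_left (s x hx) := ht ⟨x, hx⟩
  have hW : x ∈ W ⟨x, hx⟩ := ⟨hV x hx, hx⟩
  refine (X.germ_res (inf_le_right : W ⟨x, hx⟩ ≤ U) x hW t).symm.trans ?_
  rw [h1, germ_res]
  exact hs _ _ _ _ _

/-- The cospecialization map of stalks. -/
def sp {x y : X.obj} (h : x ⤳ y) : X.stalk y →* X.stalk x :=
  (X.obj.presheaf.stalkSpecializes h).hom

theorem sp_germ {x y : X.obj} (h : x ⤳ y) (U : Opens X.obj) (hy : y ∈ U) (s : X.Sec U) :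
    X.sp h (X.germ U y hy s) = X.germ U x (h.mem_open U.2 hy) s :=
  congrArg (fun f => f.hom s) (X.obj.presheaf.germ_stalkSpecializes hy h)

theorem sp_self {x : X.obj} (h : x ⤳ x) (a : X.stalk x) : X.sp h a = a := by
  obtain ⟨U, hU, s, rfl⟩ := X.exists_germ_eq a
  rw [sp_germ]

theorem sp_sp {x y z : X.obj} (h : x ⤳ y) (h' : y ⤳ z) (h'' : x ⤳ z) (a : X.stalk z) :
    X.sp h (X.sp h' a) = X.sp h'' a := by
  obtain ⟨U, hU, s, rfl⟩ := X.exists_germ_eq a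
  rw [sp_germ, sp_germ, sp_germ]

/-- A section with invertible germ at a point has an inverse nearby. -/
theorem exists_inv_near {U : Opens X.obj} {x : X.obj} (hx : x ∈ U) {s : X.Sec U}
    (h : IsUnit (X.germ U x hx s)) :
    ∃ (W : Opens X.obj) (_ : x ∈ W) (hWU : W ≤ U) (t : X.Sec W),
      ∀ y (hy : y ∈ W), X.germ U y (hWU hy) s * X.germ W y hy t = 1 := by
  obtain ⟨b, hb⟩ := h.exists_right_inv
  obtain ⟨V, hV, t, rfl⟩ := X.exists_germ_eq b
  have hUV : x ∈ U ⊓ V := ⟨hx, hV⟩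
  have e : X.germ (U ⊓ V) x hUV (X.res inf_le_left s * X.res inf_le_right t) =
      X.germ (U ⊓ V) x hUV 1 := by
    rw [map_mul, germ_res, germ_res, map_one, hb]
  obtain ⟨W, hW, h₁, h₂, H⟩ := X.exists_germ_eq_near _ _ e
  refine ⟨W, hW, h₁.trans inf_le_left, X.res (h₁.trans inf_le_right) t, fun y hy => ?_⟩
  have := H y hy
  rw [map_mul, germ_res, germ_res, map_one] at this
  rw [germ_res, this]

end Basic

section Hom

variable {X Y Z : LMS.{u}}

/-- The map on points. -/
def map (f : X ⟶ Y) : X.obj → Y.obj := f.hom.hom.base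

theorem continuous_map (f : X ⟶ Y) : Continuous (map f) := f.hom.hom.base.hom.continuous

/-- The preimage of an open set. -/
def preimage (f : X ⟶ Y) (U : Opens Y.obj) : Opens X.obj := (Opens.map f.hom.hom.base).obj U

/-- The pullback of sections. -/
def pull (f : X ⟶ Y) (U : Opens Y.obj) : Y.Sec U →* X.Sec (preimage f U) :=
  (f.hom.hom.c.app (op U)).hom

/-- The map on stalks. -/
def stalkMap (f : X ⟶ Y) (x : X.obj) : Y.stalk (map f x) →* X.stalk x :=
  (f.hom.hom.stalkMap x).hom

theorem stalkMap_germ (f : X ⟶ Y) (U : Opens Y.obj) (x : X.obj) (hx : map f x ∈ U)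
    (s : Y.Sec U) :
    stalkMap f x (Y.germ U _ hx s) = X.germ (preimage f U) x hx (pull f U s) :=
  congrArg (fun g => g.hom s) (PresheafedSpace.stalkMap_germ f.hom.hom U x hx)

theorem isUnit_stalkMap_iff (f : X ⟶ Y) (x : X.obj) (a : Y.stalk (map f x)) :
    IsUnit (stalkMap f x a) ↔ IsUnit a :=
  ⟨(f.property x).map_nonunit a, fun h => h.map _⟩

theorem map_specializes (f : X ⟶ Y) {x y : X.obj} (h : x ⤳ y) : map f x ⤳ map f y :=
  h.map (continuous_map f)

theorem stalkMap_sp (f : X ⟶ Y) {x y : X.obj} (h : x ⤳ y) (h' : map f x ⤳ map f y)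
    (a : Y.stalk (map f y)) : stalkMap f x (Y.sp h' a) = X.sp h (stalkMap f y a) := by
  obtain ⟨U, hU, s, rfl⟩ := Y.exists_germ_eq a
  rw [sp_germ, stalkMap_germ, stalkMap_germ]
  exact (X.sp_germ h (preimage f U) hU (pull f U s)).symm

theorem map_comp (f : X ⟶ Y) (g : Y ⟶ Z) (x : X.obj) : map (f ≫ g) x = map g (map f x) := rfl

theorem stalkMap_comp (f : X ⟶ Y) (g : Y ⟶ Z) (x : X.obj) (a : Z.stalk (map g (map f x))) :
    stalkMap (f ≫ g) x a = stalkMap f x (stalkMap g (map f x) a) :=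
  congrArg (fun g => g.hom a) (PresheafedSpace.stalkMap.comp f.hom.hom g.hom.hom x)

/-- The stalks at `map f x` and `map g x` are different types although the points are equal.
Throughout, the cospecialization map between equal points plays the role of a cast. -/
theorem stalkMap_congr {f g : X ⟶ Y} (e : f = g) (x : X.obj) (h : map g x ⤳ map f x)
    (a : Y.stalk (map f x)) : stalkMap f x a = stalkMap g x (Y.sp h a) := by
  subst e
  rw [sp_self]

theorem stalkMap_germ_congr {f g : X ⟶ Y} (e : f = g) (x : X.obj) (U : Opens Y.obj)
    (hf : map f x ∈ U) (hg : map g x ∈ U) (s : Y.Sec U) :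
    stalkMap f x (Y.germ U _ hf s) = stalkMap g x (Y.germ U _ hg s) := by
  subst e
  rfl

/-- Stalk maps are compared on germs of a common section, which avoids transporting along the
equality of image points. -/
theorem hom_ext {f g : X ⟶ Y} (h : ∀ x, map f x = map g x)
    (h' : ∀ (U : Opens Y.obj) (s : Y.Sec U) (x : X.obj) (hf : map f x ∈ U) (hg : map g x ∈ U),
      stalkMap f x (Y.germ U _ hf s) = stalkMap g x (Y.germ U _ hg s)) : f = g := by
  have hb : f.hom.hom.base = g.hom.hom.base := ConcreteCategory.hom_ext _ _ h
  refine WideSubcategory.hom_ext _ (SheafedSpace.hom_stalk_ext _ _ hb fun x => ?_)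
  refine CommMonCat.hom_ext (MonoidHom.ext fun a => ?_)
  obtain ⟨U, hU, s, rfl⟩ := Y.exists_germ_eq a
  refine (h' U s x hU (h x ▸ hU)).trans ?_
  exact congrArg (stalkMap g x) (Y.sp_germ (specializes_of_eq (h x).symm) U hU s).symm

/-- A morphism of monoidal spaces given by maps on stalks: the section pulled back from `s` is the
one whose germs are the images of the germs of `s`. -/
theorem exists_pull (b : C(X.obj, Y.obj)) (φ : ∀ x, Y.stalk (b x) →* X.stalk x)
    (hφ : ∀ (U : Opens Y.obj) (s : Y.Sec U) (x : X.obj) (_ : b x ∈ U),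
      ∃ (W : Opens X.obj) (_ : x ∈ W) (t : X.Sec W),
        ∀ y (hW : y ∈ W) (hU : b y ∈ U), X.germ W y hW t = φ y (Y.germ U _ hU s))
    (U : Opens Y.obj) (s : Y.Sec U) :
    ∃ t : X.Sec (U.comap b), ∀ x hx, X.germ _ x hx t = φ x (Y.germ U _ hx s) :=
  X.exists_sec (U.comap b) (fun x hx => φ x (Y.germ U _ hx s)) (fun x hx => hφ U s x hx)

/-- The pullback of sections along a continuous map and maps on stalks. -/
def pullOfStalk (b : C(X.obj, Y.obj)) (φ : ∀ x, Y.stalk (b x) →* X.stalk x)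
    (hφ : ∀ (U : Opens Y.obj) (s : Y.Sec U) (x : X.obj) (_ : b x ∈ U),
      ∃ (W : Opens X.obj) (_ : x ∈ W) (t : X.Sec W),
        ∀ y (hW : y ∈ W) (hU : b y ∈ U), X.germ W y hW t = φ y (Y.germ U _ hU s))
    (U : Opens Y.obj) : Y.Sec U →* X.Sec (U.comap b) where
  toFun s := (exists_pull b φ hφ U s).choose
  map_one' := X.sec_ext fun x hx => by
    rw [(exists_pull b φ hφ U 1).choose_spec x hx, map_one, map_one, map_one]
  map_mul' s t := X.sec_ext fun x hx => by
    rw [(exists_pull b φ hφ U _).choose_spec x hx, map_mul, map_mul, map_mul,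
      (exists_pull b φ hφ U _).choose_spec x hx, (exists_pull b φ hφ U _).choose_spec x hx]

theorem germ_pullOfStalk (b : C(X.obj, Y.obj)) (φ : ∀ x, Y.stalk (b x) →* X.stalk x)
    (hφ : ∀ (U : Opens Y.obj) (s : Y.Sec U) (x : X.obj) (_ : b x ∈ U),
      ∃ (W : Opens X.obj) (_ : x ∈ W) (t : X.Sec W),
        ∀ y (hW : y ∈ W) (hU : b y ∈ U), X.germ W y hW t = φ y (Y.germ U _ hU s))
    (U : Opens Y.obj) (s : Y.Sec U) (x : X.obj) (hx : b x ∈ U) :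
    X.germ _ x hx (pullOfStalk b φ hφ U s) = φ x (Y.germ U _ hx s) :=
  (exists_pull b φ hφ U s).choose_spec x hx

/-- A morphism of monoidal spaces from a continuous map and maps on stalks. -/
def homOfStalkAux (b : C(X.obj, Y.obj)) (φ : ∀ x, Y.stalk (b x) →* X.stalk x)
    (hφ : ∀ (U : Opens Y.obj) (s : Y.Sec U) (x : X.obj) (_ : b x ∈ U),
      ∃ (W : Opens X.obj) (_ : x ∈ W) (t : X.Sec W),
        ∀ y (hW : y ∈ W) (hU : b y ∈ U), X.germ W y hW t = φ y (Y.germ U _ hU s)) :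
    X.obj ⟶ Y.obj :=
  InducedCategory.homMk
    { base := TopCat.ofHom b
      c :=
        { app := fun U => CommMonCat.ofHom (pullOfStalk b φ hφ U.unop)
          naturality := fun U V i => by
            refine CommMonCat.hom_ext (MonoidHom.ext fun s => X.sec_ext fun x hx => ?_)
            have h1 := germ_pullOfStalk b φ hφ V.unop (Y.res i.unop.le s) x hx
            have h2 := germ_pullOfStalk b φ hφ U.unop s x (i.unop.le hx)
            have h0 := congrArg (φ x) (Y.germ_res i.unop.le (b x) hx s)
            have h3 := X.germ_res (U := U.unop.comap b) (V := V.unop.comap b)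
              (fun y hy => i.unop.le hy) x hx (pullOfStalk b φ hφ U.unop s)
            exact (h1.trans h0).trans (h2.symm.trans h3.symm) } }

theorem stalkMap_homOfStalkAux (b : C(X.obj, Y.obj)) (φ : ∀ x, Y.stalk (b x) →* X.stalk x)
    (hφ : ∀ (U : Opens Y.obj) (s : Y.Sec U) (x : X.obj) (_ : b x ∈ U),
      ∃ (W : Opens X.obj) (_ : x ∈ W) (t : X.Sec W),
        ∀ y (hW : y ∈ W) (hU : b y ∈ U), X.germ W y hW t = φ y (Y.germ U _ hU s)) (x : X.obj)
    (a : Y.stalk (b x)) : ((homOfStalkAux b φ hφ).hom.stalkMap x).hom a = φ x a := by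
  obtain ⟨U, hU, s, rfl⟩ := Y.exists_germ_eq a
  exact (congrArg (fun g => g.hom s)
    (PresheafedSpace.stalkMap_germ (homOfStalkAux b φ hφ).hom U x hU)).trans
    (germ_pullOfStalk b φ hφ U s x hU)

/-- A morphism of locally monoidal spaces from a continuous map and local maps on stalks. -/
def homOfStalk (b : C(X.obj, Y.obj)) (φ : ∀ x, Y.stalk (b x) →* X.stalk x)
    (hφ : ∀ (U : Opens Y.obj) (s : Y.Sec U) (x : X.obj) (_ : b x ∈ U),
      ∃ (W : Opens X.obj) (_ : x ∈ W) (t : X.Sec W),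
        ∀ y (hW : y ∈ W) (hU : b y ∈ U), X.germ W y hW t = φ y (Y.germ U _ hU s))
    (hl : ∀ x a, IsUnit (φ x a) → IsUnit a) : X ⟶ Y :=
  ⟨homOfStalkAux b φ hφ, fun x => ⟨fun a ha => hl x a (by
    rw [stalkMap_homOfStalkAux b φ hφ x a] at ha
    exact ha)⟩⟩

theorem stalkMap_homOfStalk (b : C(X.obj, Y.obj)) (φ : ∀ x, Y.stalk (b x) →* X.stalk x) (hφ)
    (hl : ∀ x a, IsUnit (φ x a) → IsUnit a) (x : X.obj) (a : Y.stalk (b x)) :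
    stalkMap (homOfStalk b φ hφ hl) x a = φ x a :=
  stalkMap_homOfStalkAux b φ hφ x a

end Hom

end LMS

/-! ## Locally monoidal spaces given by families -/

namespace OfFamilies

open LMS

variable {T : TopCat.{u}} {M : T → Type u} [∀ t, CommMonoid (M t)] (p : TopCat.PrelocalPredicate M)
  (h₁ : ∀ U : Opens T, p.pred (1 : ∀ t : U, M t))
  (h₂ : ∀ {U : Opens T} {σ τ : ∀ t : U, M t}, p.pred σ → p.pred τ → p.pred (σ * τ))

include h₁ h₂ in
/-- The families which locally satisfy a predicate. -/
def secs (U : Opens T) : Submonoid (∀ t : U, M t) where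
  carrier := {σ | p.sheafify.pred σ}
  one_mem' := fun t => ⟨U, t.2, 𝟙 _, h₁ U⟩
  mul_mem' := by
    intro σ τ hσ hτ t
    obtain ⟨N, hN, i, h⟩ := hσ t
    obtain ⟨N', hN', i', h'⟩ := hτ t
    exact ⟨N ⊓ N', ⟨hN, hN'⟩, Opens.infLELeft _ _ ≫ i,
      h₂ (p.res (Opens.infLELeft _ _) _ h) (p.res (Opens.infLERight _ _) _ h')⟩

/-- The presheaf of families which locally satisfy a predicate. -/
def presheaf : TopCat.Presheaf CommMonCat.{u} T where
  obj U := CommMonCat.of (secs p h₁ h₂ U.unop)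
  map i := CommMonCat.ofHom
    { toFun := fun s => ⟨fun t => s.1 (i.unop t), p.sheafify.res i.unop s.1 s.2⟩
      map_one' := rfl
      map_mul' := fun _ _ => rfl }

theorem presheaf_isSheaf : (presheaf p h₁ h₂).IsSheaf := by
  refine (TopCat.Presheaf.isSheaf_iff_isSheaf_comp (forget CommMonCat) _).mpr ?_
  refine TopCat.Presheaf.isSheaf_of_iso ?_ (TopCat.subpresheafToTypes.isSheaf p.sheafify)
  exact NatIso.ofComponents (fun _ => Iso.refl _)

/-- The locally monoidal space whose sections are the families which locally satisfy a
predicate. -/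
def space : LMS.{u} :=
  ⟨{ carrier := T
     presheaf := presheaf p h₁ h₂
     IsSheaf := presheaf_isSheaf p h₁ h₂ }⟩

/-- The value at `t` of a germ at `t`. -/
def evHom (t : T) : (presheaf p h₁ h₂).stalk t ⟶ CommMonCat.of (M t) :=
  colimit.desc _
    { pt := CommMonCat.of (M t)
      ι :=
        { app := fun U => CommMonCat.ofHom
            ((Pi.evalMonoidHom (fun G : U.unop.1 => M G.1) ⟨t, U.unop.2⟩).comp
              (secs p h₁ h₂ U.unop.1).subtype)
          naturality := fun _ _ _ => rfl } }

/-- The value at `t` of a germ at `t`. -/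
def ev (t : T) : (space p h₁ h₂).stalk t →* M t := (evHom p h₁ h₂ t).hom

theorem ev_germ (t : T) (U : Opens T) (ht : t ∈ U) (s : secs p h₁ h₂ U) :
    ev p h₁ h₂ t ((space p h₁ h₂).germ U t ht s) = s.1 ⟨t, ht⟩ := by
  have := colimit.ι_desc (F := (OpenNhds.inclusion t).op ⋙ presheaf p h₁ h₂)
    { pt := CommMonCat.of (M t)
      ι :=
        { app := fun U => CommMonCat.ofHom
            ((Pi.evalMonoidHom (fun G : U.unop.1 => M G.1) ⟨t, U.unop.2⟩).comp
              (secs p h₁ h₂ U.unop.1).subtype)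
          naturality := fun _ _ _ => rfl } } (op ⟨U, ht⟩)
  exact congrArg (fun f => f.hom s) this

theorem exists_sec {U : Opens T} {σ : ∀ t : U, M t} (hσ : p.pred σ) :
    ∃ s : (space p h₁ h₂).Sec U,
      ∀ t ht, ev p h₁ h₂ t ((space p h₁ h₂).germ U t ht s) = σ ⟨t, ht⟩ :=
  ⟨(⟨σ, fun t => ⟨U, t.2, 𝟙 _, hσ⟩⟩ : secs p h₁ h₂ U), fun t ht => ev_germ p h₁ h₂ t U ht _⟩

theorem sec_ext {U : Opens T} {s s' : (space p h₁ h₂).Sec U}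
    (h : ∀ t ht, ev p h₁ h₂ t ((space p h₁ h₂).germ U t ht s) =
      ev p h₁ h₂ t ((space p h₁ h₂).germ U t ht s')) : s = s' := by
  refine Subtype.ext (funext fun t => ?_)
  exact (ev_germ p h₁ h₂ t.1 U t.2 s).symm.trans ((h t.1 t.2).trans (ev_germ p h₁ h₂ t.1 U t.2 s'))

theorem exists_pred {U : Opens T} (s : (space p h₁ h₂).Sec U) {t : T} (ht : t ∈ U) :
    ∃ (N : Opens T) (_ : t ∈ N) (h : N ≤ U) (σ : ∀ t : N, M t) (_ : p.pred σ),
      ∀ t' (ht' : t' ∈ N), ev p h₁ h₂ t' ((space p h₁ h₂).germ U t' (h ht') s) = σ ⟨t', ht'⟩ := by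
  obtain ⟨N, hN, i, h⟩ := s.2 ⟨t, ht⟩
  exact ⟨N, hN, i.le, _, h, fun t' ht' => ev_germ p h₁ h₂ t' U (i.le ht') s⟩

end OfFamilies

/-! ## Fiber products of locally monoidal spaces -/

namespace Pb

open LMS

section Construction

variable {X Y S : LMS.{u}} (f : X ⟶ S) (g : Y ⟶ S)

/-- The points of the fiber product. -/
def Pt : Type u := {t : X.obj × Y.obj // map f t.1 = map g t.2}

instance : TopologicalSpace (Pt f g) :=
  inferInstanceAs (TopologicalSpace {t : X.obj × Y.obj // map f t.1 = map g t.2})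

variable {f g}

/-- The stalk of the base, mapped to the first factor. -/
def toFst (t : Pt f g) : S.stalk (map f t.1.1) →* X.stalk t.1.1 := stalkMap f t.1.1

/-- The stalk of the base, mapped to the second factor. -/
def toSnd (t : Pt f g) : S.stalk (map f t.1.1) →* Y.stalk t.1.2 :=
  (stalkMap g t.1.2).comp (S.sp (specializes_of_eq t.2.symm))

theorem isUnit_toFst (t : Pt f g) (a) (h : IsUnit (toFst t a)) : IsUnit a :=
  (isUnit_stalkMap_iff f _ a).1 h

theorem isUnit_toSnd (t : Pt f g) (a) (h : IsUnit (toSnd t a)) : IsUnit a := by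
  have h1 := ((isUnit_stalkMap_iff g _ _).1 h).map (S.sp (specializes_of_eq t.2))
  rw [S.sp_sp _ _ (specializes_refl _), S.sp_self] at h1
  exact h1

/-- The stalk of the fiber product at a point. -/
abbrev Fib (t : Pt f g) : Type u := Amalg (toFst t) (toSnd t)

variable (f g) in
/-- Families of elements which are given by one pair of sections of the factors. -/
def isPair : TopCat.PrelocalPredicate (X := TopCat.of (Pt f g)) (fun t : Pt f g => Fib t) where
  pred {U} σ := ∃ (V : Opens X.obj) (W : Opens Y.obj) (a : X.Sec V) (b : Y.Sec W),
    ∀ t (ht : t ∈ U), ∃ (h₁ : t.1.1 ∈ V) (h₂ : t.1.2 ∈ W),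
      σ ⟨t, ht⟩ = Amalg.mk (toFst t) (toSnd t) (X.germ V _ h₁ a, Y.germ W _ h₂ b)
  res := by
    rintro V U i σ ⟨V', W', a, b, h⟩
    exact ⟨V', W', a, b, fun t ht => h t (i.le ht)⟩

theorem isPair_one (U : Opens (TopCat.of (Pt f g))) :
    (isPair f g).pred (1 : ∀ t : U, Fib t.1) :=
  ⟨⊤, ⊤, 1, 1, fun t ht => ⟨trivial, trivial, by
    rw [map_one, map_one]
    exact (map_one (Amalg.mk (toFst t) (toSnd t))).symm⟩⟩

theorem isPair_mul {U : Opens (TopCat.of (Pt f g))} {σ τ : ∀ t : U, Fib t.1}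
    (hσ : (isPair f g).pred σ) (hτ : (isPair f g).pred τ) : (isPair f g).pred (σ * τ) := by
  obtain ⟨V, W, a, b, h⟩ := hσ
  obtain ⟨V', W', a', b', h'⟩ := hτ
  refine ⟨V ⊓ V', W ⊓ W', X.res inf_le_left a * X.res inf_le_right a',
    Y.res inf_le_left b * Y.res inf_le_right b', fun t ht => ?_⟩
  obtain ⟨h₁, h₂, e⟩ := h t ht
  obtain ⟨h₁', h₂', e'⟩ := h' t ht
  have k₁ : t.1.1 ∈ V ⊓ V' := ⟨h₁, h₁'⟩
  have k₂ : t.1.2 ∈ W ⊓ W' := ⟨h₂, h₂'⟩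
  refine ⟨k₁, k₂, (congrArg₂ (· * ·) e e').trans ?_⟩
  rw [map_mul, map_mul, germ_res, germ_res, germ_res, germ_res]
  exact (map_mul (Amalg.mk (toFst t) (toSnd t)) _ _).symm

variable (f g) in
/-- The fiber product of two morphisms of locally monoidal spaces. -/
def obj : LMS.{u} := OfFamilies.space (isPair f g) isPair_one isPair_mul

/-- A point of the fiber product, as a pair. -/
def pt (t : (obj f g).obj) : Pt f g := t

/-- A pair, as a point of the fiber product. -/
def ofPt (t : Pt f g) : (obj f g).obj := t

theorem continuous_pt : Continuous (pt : (obj f g).obj → Pt f g) := continuous_id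

theorem continuous_ofPt : Continuous (ofPt : Pt f g → (obj f g).obj) := continuous_id

/-- The first coordinate of a point of the fiber product. -/
def fstPt : C((obj f g).obj, X.obj) :=
  ⟨fun t => (pt t).1.1, (continuous_fst.comp continuous_subtype_val).comp continuous_pt⟩

/-- The second coordinate of a point of the fiber product. -/
def sndPt : C((obj f g).obj, Y.obj) :=
  ⟨fun t => (pt t).1.2, (continuous_snd.comp continuous_subtype_val).comp continuous_pt⟩

theorem condPt (t : (obj f g).obj) : map f (pt t).1.1 = map g (pt t).1.2 := (pt t).2

theorem ptExt {t t' : (obj f g).obj} (h : (pt t).1.1 = (pt t').1.1)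
    (h' : (pt t).1.2 = (pt t').1.2) : t = t' :=
  Subtype.ext (Prod.ext h h')

/-- The product of two open sets, in the fiber product. -/
def box (V : Opens X.obj) (W : Opens Y.obj) : Opens (obj f g).obj := V.comap fstPt ⊓ W.comap sndPt

theorem mem_box {V : Opens X.obj} {W : Opens Y.obj} {t : (obj f g).obj} :
    t ∈ (box V W : Opens (obj f g).obj) ↔ (pt t).1.1 ∈ V ∧ (pt t).1.2 ∈ W := Iff.rfl

theorem exists_box_le {U : Opens (obj f g).obj} {t : (obj f g).obj} (ht : t ∈ U) :
    ∃ (V : Opens X.obj) (W : Opens Y.obj), t ∈ (box V W : Opens (obj f g).obj) ∧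
      box V W ≤ U := by
  obtain ⟨O, hO, hOU⟩ := isOpen_induced_iff.1 U.2
  have hOU' : ∀ t : (obj f g).obj, ((pt t).1.1, (pt t).1.2) ∈ O ↔ t ∈ U := fun t => by
    change t ∈ Subtype.val ⁻¹' O ↔ t ∈ U.carrier
    rw [← hOU]
    exact Iff.rfl
  obtain ⟨V, W, hV, hW, h1, h2, h3⟩ := isOpen_prod_iff.1 hO _ _ ((hOU' t).2 ht)
  exact ⟨⟨V, hV⟩, ⟨W, hW⟩, ⟨h1, h2⟩, fun t' h => (hOU' t').1 (h3 ⟨h.1, h.2⟩)⟩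

/-- The value at `t` of a germ at `t`. -/
def ev (t : (obj f g).obj) : (obj f g).stalk t →* Fib (pt t) :=
  OfFamilies.ev (isPair f g) isPair_one isPair_mul t

theorem exists_pairSec {V : Opens X.obj} {W : Opens Y.obj} (a : X.Sec V) (b : Y.Sec W) :
    ∃ s : (obj f g).Sec (box V W), ∀ (t : (obj f g).obj) (ht : t ∈ box V W)
      (h₁ : (pt t).1.1 ∈ V) (h₂ : (pt t).1.2 ∈ W), ev t ((obj f g).germ (box V W) t ht s) =
        Amalg.mk (toFst (pt t)) (toSnd (pt t)) (X.germ V _ h₁ a, Y.germ W _ h₂ b) := by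
  obtain ⟨s, hs⟩ := OfFamilies.exists_sec (isPair f g) isPair_one isPair_mul (U := box V W)
    (σ := fun t => Amalg.mk (toFst (pt t.1)) (toSnd (pt t.1))
      (X.germ V (pt t.1).1.1 (mem_box.1 t.2).1 a, Y.germ W (pt t.1).1.2 (mem_box.1 t.2).2 b))
    ⟨V, W, a, b, fun t ht => ⟨(mem_box.1 ht).1, (mem_box.1 ht).2, rfl⟩⟩
  exact ⟨s, fun t ht _ _ => hs t ht⟩

/-- The section given by a pair of sections of the factors. -/
def pairSec {V : Opens X.obj} {W : Opens Y.obj} (a : X.Sec V) (b : Y.Sec W) :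
    (obj f g).Sec (box V W) := (exists_pairSec a b).choose

theorem ev_germ_pairSec {V : Opens X.obj} {W : Opens Y.obj} (a : X.Sec V) (b : Y.Sec W)
    (t : (obj f g).obj) (ht : t ∈ (box V W : Opens (obj f g).obj)) (h₁ : (pt t).1.1 ∈ V)
    (h₂ : (pt t).1.2 ∈ W) :
    ev t ((obj f g).germ (box V W) t ht (pairSec a b)) =
      Amalg.mk (toFst (pt t)) (toSnd (pt t)) (X.germ V _ h₁ a, Y.germ W _ h₂ b) :=
  (exists_pairSec a b).choose_spec t ht h₁ h₂

/-- Sections of the fiber product are locally given by pairs. -/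
theorem exists_pair {U : Opens (obj f g).obj} (s : (obj f g).Sec U) {t : (obj f g).obj}
    (ht : t ∈ U) :
    ∃ (N : Opens (obj f g).obj) (_ : t ∈ N) (h : N ≤ U) (V : Opens X.obj) (W : Opens Y.obj)
      (a : X.Sec V) (b : Y.Sec W), ∀ t' (ht' : t' ∈ N), ∃ (h₁ : (pt t').1.1 ∈ V)
      (h₂ : (pt t').1.2 ∈ W), ev t' ((obj f g).germ U t' (h ht') s) =
        Amalg.mk (toFst (pt t')) (toSnd (pt t')) (X.germ V _ h₁ a, Y.germ W _ h₂ b) := by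
  obtain ⟨N, hN, h, σ, ⟨V, W, a, b, H⟩, e⟩ :=
    OfFamilies.exists_pred (isPair f g) isPair_one isPair_mul s ht
  refine ⟨N, hN, h, V, W, a, b, fun t' ht' => ?_⟩
  obtain ⟨h₁, h₂, e'⟩ := H t' ht'
  exact ⟨h₁, h₂, (e t' ht').trans e'⟩

/-- Germs are equal if their values agree near the point. -/
theorem germ_eq_of_ev {U U' N : Opens (obj f g).obj} {t : (obj f g).obj} (hN : t ∈ N)
    (h : N ≤ U) (h' : N ≤ U') {s : (obj f g).Sec U} {s' : (obj f g).Sec U'}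
    (e : ∀ t' (ht' : t' ∈ N), ev t' ((obj f g).germ U t' (h ht') s) =
      ev t' ((obj f g).germ U' t' (h' ht') s')) (ht : t ∈ U) (ht' : t ∈ U') :
    (obj f g).germ U t ht s = (obj f g).germ U' t ht' s' := by
  have : (obj f g).res h s = (obj f g).res h' s' := by
    refine OfFamilies.sec_ext (isPair f g) isPair_one isPair_mul fun t' ht' => ?_
    have h1 := (obj f g).germ_res h t' ht' s
    have h2 := (obj f g).germ_res h' t' ht' s'
    exact (congrArg (ev t') h1).trans ((e t' ht').trans (congrArg (ev t') h2).symm)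
  rw [← (obj f g).germ_res h t hN, ← (obj f g).germ_res h' t hN, this]

theorem exists_germ_pairSec {t : (obj f g).obj} (z : (obj f g).stalk t) :
    ∃ (V : Opens X.obj) (W : Opens Y.obj) (a : X.Sec V) (b : Y.Sec W)
      (h : t ∈ (box V W : Opens (obj f g).obj)),
      z = (obj f g).germ (box V W) t h (pairSec a b) := by
  obtain ⟨U, hU, s, rfl⟩ := (obj f g).exists_germ_eq z
  obtain ⟨N, hN, h, V, W, a, b, H⟩ := exists_pair s hU
  have hbox : N ≤ box V W := fun t' ht' => mem_box.2 ⟨(H t' ht').choose, (H t' ht').choose_spec.choose⟩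
  refine ⟨V, W, a, b, hbox hN, germ_eq_of_ev hN h hbox (fun t' ht' => ?_) _ _⟩
  obtain ⟨h₁, h₂, e⟩ := H t' ht'
  rw [e, ev_germ_pairSec a b t' _ h₁ h₂]

theorem ev_surjective (t : (obj f g).obj) : Function.Surjective (ev t) := by
  intro z
  obtain ⟨⟨α, β⟩, rfl⟩ := Amalg.mk_surjective _ _ z
  obtain ⟨V, hV, a, rfl⟩ := X.exists_germ_eq α
  obtain ⟨W, hW, b, rfl⟩ := Y.exists_germ_eq β
  exact ⟨_, ev_germ_pairSec a b t (mem_box.2 ⟨hV, hW⟩) hV hW⟩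

theorem germ_pairSec_eq {t : (obj f g).obj} {V V' N : Opens X.obj} {W W' N' : Opens Y.obj}
    {a : X.Sec V} {a' : X.Sec V'} {b : Y.Sec W} {b' : Y.Sec W'} (hN : (pt t).1.1 ∈ N)
    (hN' : (pt t).1.2 ∈ N') (i : N ≤ V) (j : N ≤ V') (i' : N' ≤ W) (j' : N' ≤ W')
    (e : ∀ (t' : (obj f g).obj) (h₁ : (pt t').1.1 ∈ N) (h₂ : (pt t').1.2 ∈ N'),
      Amalg.mk (toFst (pt t')) (toSnd (pt t')) (X.germ V _ (i h₁) a, Y.germ W _ (i' h₂) b) =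
      Amalg.mk (toFst (pt t')) (toSnd (pt t')) (X.germ V' _ (j h₁) a', Y.germ W' _ (j' h₂) b'))
    (h : t ∈ (box V W : Opens (obj f g).obj)) (h' : t ∈ (box V' W' : Opens (obj f g).obj)) :
    (obj f g).germ (box V W) t h (pairSec a b) =
      (obj f g).germ (box V' W') t h' (pairSec a' b') := by
  have k : (box N N' : Opens (obj f g).obj) ≤ box V W := fun t' h =>
    mem_box.2 ⟨i (mem_box.1 h).1, i' (mem_box.1 h).2⟩
  have k' : (box N N' : Opens (obj f g).obj) ≤ box V' W' := fun t' h =>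
    mem_box.2 ⟨j (mem_box.1 h).1, j' (mem_box.1 h).2⟩
  refine germ_eq_of_ev (mem_box.2 ⟨hN, hN'⟩) k k' (fun t' h => ?_) _ _
  have h₁ := (mem_box.1 h).1
  have h₂ := (mem_box.1 h).2
  rw [ev_germ_pairSec a b t' _ (i h₁) (i' h₂), ev_germ_pairSec a' b' t' _ (j h₁) (j' h₂)]
  exact e t' h₁ h₂

/-- A germ of the fiber product with given components. -/
theorem exists_rep (t : (obj f g).obj) (z : X.stalk (pt t).1.1 × Y.stalk (pt t).1.2) :
    ∃ y : (obj f g).stalk t, ∀ (V : Opens X.obj) (W : Opens Y.obj) (a : X.Sec V) (b : Y.Sec W)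
      (h₁ : (pt t).1.1 ∈ V) (h₂ : (pt t).1.2 ∈ W) (h : t ∈ (box V W : Opens (obj f g).obj)),
      z = (X.germ V _ h₁ a, Y.germ W _ h₂ b) →
        y = (obj f g).germ (box V W) t h (pairSec a b) := by
  obtain ⟨α, β⟩ := z
  obtain ⟨V, hV, a, rfl⟩ := X.exists_germ_eq α
  obtain ⟨W, hW, b, rfl⟩ := Y.exists_germ_eq β
  refine ⟨(obj f g).germ (box V W) t (mem_box.2 ⟨hV, hW⟩) (pairSec a b), ?_⟩
  intro V' W' a' b' h₁ h₂ h e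
  obtain ⟨N, hN, i, j, H⟩ := X.exists_germ_eq_near _ _ (congrArg Prod.fst e)
  obtain ⟨N', hN', i', j', H'⟩ := Y.exists_germ_eq_near _ _ (congrArg Prod.snd e)
  exact germ_pairSec_eq hN hN' i j i' j' (fun t' h₁ h₂ => by rw [H _ h₁, H' _ h₂]) _ _

/-- A pair of germs `z` yields a germ `rep z` of the fiber product, multiplicatively in `z`, so `rep
z = rep z'` is a congruence. It contains the generators of the amalgamated sum; hence germs with
equal values are equal. -/
theorem ev_injective (t : (obj f g).obj) : Function.Injective (ev t) := by
  choose rep rep_eq using exists_rep t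
  have rep_mul : ∀ z z', rep (z * z') = rep z * rep z' := by
    rintro ⟨α, β⟩ ⟨α', β'⟩
    obtain ⟨V, hV, a, rfl⟩ := X.exists_germ_eq α
    obtain ⟨W, hW, b, rfl⟩ := Y.exists_germ_eq β
    obtain ⟨V', hV', a', rfl⟩ := X.exists_germ_eq α'
    obtain ⟨W', hW', b', rfl⟩ := Y.exists_germ_eq β'
    have e2 : ∀ (x : X.obj) (hx : x ∈ V ⊓ V'), X.germ _ x hx
        (X.res inf_le_left a * X.res inf_le_right a') =
        X.germ V x hx.1 a * X.germ V' x hx.2 a' := fun x hx => by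
      rw [map_mul, germ_res, germ_res]
    have e3 : ∀ (x : Y.obj) (hx : x ∈ W ⊓ W'), Y.germ _ x hx
        (Y.res inf_le_left b * Y.res inf_le_right b') =
        Y.germ W x hx.1 b * Y.germ W' x hx.2 b' := fun x hx => by
      rw [map_mul, germ_res, germ_res]
    have k₁ : (pt t).1.1 ∈ V ⊓ V' := ⟨hV, hV'⟩
    have k₂ : (pt t).1.2 ∈ W ⊓ W' := ⟨hW, hW'⟩
    have h1 : (box (V ⊓ V') (W ⊓ W') : Opens (obj f g).obj) ≤ box V W := fun t' h' =>
      mem_box.2 ⟨(mem_box.1 h').1.1, (mem_box.1 h').2.1⟩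
    have h2 : (box (V ⊓ V') (W ⊓ W') : Opens (obj f g).obj) ≤ box V' W' := fun t' h' =>
      mem_box.2 ⟨(mem_box.1 h').1.2, (mem_box.1 h').2.2⟩
    have hb : t ∈ (box (V ⊓ V') (W ⊓ W') : Opens (obj f g).obj) := mem_box.2 ⟨k₁, k₂⟩
    rw [rep_eq _ V W a b hV hW (h1 hb) rfl, rep_eq _ V' W' a' b' hV' hW' (h2 hb) rfl,
      rep_eq _ (V ⊓ V') (W ⊓ W') _ _ k₁ k₂ hb (Prod.ext (e2 _ k₁).symm (e3 _ k₂).symm),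
      ← (obj f g).germ_res h1 t hb, ← (obj f g).germ_res h2 t hb, ← map_mul]
    refine germ_eq_of_ev hb le_rfl le_rfl (fun t' ht' => ?_) _ _
    have l₁ := (mem_box.1 ht').1
    have l₂ := (mem_box.1 ht').2
    rw [ev_germ_pairSec _ _ t' ht' l₁ l₂, e2, e3, map_mul, map_mul, germ_res, germ_res,
      ev_germ_pairSec _ _ t' _ l₁.1 l₂.1, ev_germ_pairSec _ _ t' _ l₁.2 l₂.2, ← map_mul]
    rfl
  let C : Con (X.stalk (pt t).1.1 × Y.stalk (pt t).1.2) :=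
    { r := fun z z' => rep z = rep z'
      iseqv := ⟨fun _ => rfl, fun e => e.symm, fun e e' => e.trans e'⟩
      mul' := fun {w x y z} e e' => by rw [rep_mul, rep_mul, e, e'] }
  have hC : ∀ q, C (toFst (pt t) q, 1) (1, toSnd (pt t) q) := by
    intro q
    -- The element `q` spreads out to a section `s`. Its two pullbacks are identified in the
    -- amalgamated sum at every point of a box, which yields equality of germs and not only of
    -- values at `t`.
    obtain ⟨U, hU, s, rfl⟩ := S.exists_germ_eq q
    have e1 : ∀ t' : Pt f g, ∀ h : map f t'.1.1 ∈ U, toFst t' (S.germ U _ h s) =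
        X.germ (preimage f U) t'.1.1 h (pull f U s) := fun t' h => stalkMap_germ _ _ _ _ _
    have e2 : ∀ t' : Pt f g, ∀ (h : map f t'.1.1 ∈ U) (h' : map g t'.1.2 ∈ U),
        toSnd t' (S.germ U _ h s) = Y.germ (preimage g U) t'.1.2 h' (pull g U s) := fun t' h h' =>
      (congrArg (stalkMap g t'.1.2) (S.sp_germ _ U h s)).trans (stalkMap_germ _ _ _ _ _)
    have hU' : map g (pt t).1.2 ∈ U := condPt t ▸ hU
    change rep _ = rep _
    rw [rep_eq _ (preimage f U) ⊤ (pull f U s) 1 hU trivial (mem_box.2 ⟨hU, trivial⟩)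
        (Prod.ext (e1 _ hU) (map_one _).symm),
      rep_eq _ ⊤ (preimage g U) 1 (pull g U s) trivial hU' (mem_box.2 ⟨trivial, hU'⟩)
        (Prod.ext (map_one _).symm (e2 _ hU hU'))]
    refine germ_pairSec_eq (N := preimage f U) (N' := preimage g U) hU hU' le_rfl le_top le_top
      le_rfl (fun t' h₁ h₂ => ?_) _ _
    have e3 := (Amalg.mk_eq_iff (toFst (pt t')) (toSnd (pt t'))).2
      (ConGen.Rel.of _ _ ⟨S.germ U _ h₁ s, rfl, rfl⟩)
    rw [map_one, map_one, ← e1 _ h₁, ← e2 _ h₁ h₂]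
    exact e3
  intro z z' e
  obtain ⟨V, W, a, b, h, rfl⟩ := exists_germ_pairSec z
  obtain ⟨V', W', a', b', h', rfl⟩ := exists_germ_pairSec z'
  have h₁ := mem_box.1 h
  have h₂ := mem_box.1 h'
  rw [ev_germ_pairSec a b t h h₁.1 h₁.2, ev_germ_pairSec a' b' t h' h₂.1 h₂.2] at e
  exact (rep_eq _ V W a b h₁.1 h₁.2 h rfl).symm.trans
    ((Amalg.con_of_mk_eq C hC e).trans (rep_eq _ V' W' a' b' h₂.1 h₂.2 h' rfl))

/-- The stalk of the fiber product is the amalgamated sum of the stalks. -/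
def stalkEquiv (t : (obj f g).obj) : (obj f g).stalk t ≃* Fib (pt t) :=
  MulEquiv.ofBijective (ev t) ⟨ev_injective t, ev_surjective t⟩

end Construction

end Pb

/-! ## The universal property of the fiber product -/

namespace Pb

open LMS

section Universal

variable {X Y S : LMS.{u}} {f : X ⟶ S} {g : Y ⟶ S}

theorem stalkEquiv_germ_pairSec {V : Opens X.obj} {W : Opens Y.obj} (a : X.Sec V) (b : Y.Sec W)
    (t : (obj f g).obj) (ht : t ∈ (box V W : Opens (obj f g).obj)) (h₁ : (pt t).1.1 ∈ V)
    (h₂ : (pt t).1.2 ∈ W) :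
    (obj f g).germ (box V W) t ht (pairSec a b) =
      (stalkEquiv t).symm (Amalg.mk (toFst (pt t)) (toSnd (pt t))
        (X.germ V _ h₁ a, Y.germ W _ h₂ b)) :=
  (MulEquiv.eq_symm_apply _).2 (ev_germ_pairSec a b t ht h₁ h₂)

theorem isUnit_stalkEquiv_symm (t : (obj f g).obj) (z : Fib (pt t)) :
    IsUnit ((stalkEquiv t).symm z) ↔ IsUnit z :=
  ⟨fun h => by simpa using h.map (stalkEquiv t), fun h => h.map _⟩

variable (f g) in
/-- The first projection. -/
def fst : obj f g ⟶ X :=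
  homOfStalk fstPt (fun t => (stalkEquiv t).symm.toMonoidHom.comp (Amalg.inl _ _))
    (fun U s t ht => ⟨box U ⊤, mem_box.2 ⟨ht, trivial⟩, pairSec s 1, fun t' h h' => by
      refine (stalkEquiv_germ_pairSec _ _ t' h h' trivial).trans ?_
      rw [map_one]
      rfl⟩)
    (fun t a h => (Amalg.isUnit_inl_iff (isUnit_toFst _) (isUnit_toSnd _) a).1
      ((isUnit_stalkEquiv_symm t _).1 h))

variable (f g) in
/-- The second projection. -/
def snd : obj f g ⟶ Y :=
  homOfStalk sndPt (fun t => (stalkEquiv t).symm.toMonoidHom.comp (Amalg.inr _ _))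
    (fun U s t ht => ⟨box ⊤ U, mem_box.2 ⟨trivial, ht⟩, pairSec 1 s, fun t' h h' => by
      refine (stalkEquiv_germ_pairSec _ _ t' h trivial h').trans ?_
      rw [map_one]
      rfl⟩)
    (fun t a h => (Amalg.isUnit_inr_iff (isUnit_toFst _) (isUnit_toSnd _) a).1
      ((isUnit_stalkEquiv_symm t _).1 h))

theorem stalkMap_fst (t : (obj f g).obj) (a : X.stalk (pt t).1.1) :
    stalkMap (fst f g) t a = (stalkEquiv t).symm (Amalg.inl _ _ a) :=
  stalkMap_homOfStalk fstPt (fun t => (stalkEquiv t).symm.toMonoidHom.comp (Amalg.inl _ _)) _ _ t a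

theorem stalkMap_snd (t : (obj f g).obj) (a : Y.stalk (pt t).1.2) :
    stalkMap (snd f g) t a = (stalkEquiv t).symm (Amalg.inr _ _ a) :=
  stalkMap_homOfStalk sndPt (fun t => (stalkEquiv t).symm.toMonoidHom.comp (Amalg.inr _ _)) _ _ t a

theorem stalkEquiv_symm_mk (t : (obj f g).obj) (a : X.stalk (pt t).1.1) (b : Y.stalk (pt t).1.2) :
    (stalkEquiv t).symm (Amalg.mk _ _ (a, b)) =
      stalkMap (fst f g) t a * stalkMap (snd f g) t b := by
  rw [stalkMap_fst, stalkMap_snd, ← map_mul, Amalg.inl_mul_inr]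

/-- Sections of the fiber product are locally products of sections of the factors. -/
theorem exists_pair' {U : Opens (obj f g).obj} (s : (obj f g).Sec U) {t : (obj f g).obj}
    (ht : t ∈ U) :
    ∃ (N : Opens (obj f g).obj) (_ : t ∈ N) (h : N ≤ U) (V : Opens X.obj) (W : Opens Y.obj)
      (a : X.Sec V) (b : Y.Sec W), ∀ t' (ht' : t' ∈ N), ∃ (h₁ : map (fst f g) t' ∈ V)
      (h₂ : map (snd f g) t' ∈ W), (obj f g).germ U t' (h ht') s =
        stalkMap (fst f g) t' (X.germ V _ h₁ a) * stalkMap (snd f g) t' (Y.germ W _ h₂ b) := by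
  obtain ⟨N, hN, h, V, W, a, b, H⟩ := exists_pair s ht
  refine ⟨N, hN, h, V, W, a, b, fun t' ht' => ?_⟩
  obtain ⟨h₁, h₂, e⟩ := H t' ht'
  exact ⟨h₁, h₂, ((MulEquiv.eq_symm_apply (stalkEquiv t')).2 e).trans
    (stalkEquiv_symm_mk t' _ _)⟩

theorem condition : fst f g ≫ f = snd f g ≫ g := by
  refine hom_ext condPt fun U s t h h' => ?_
  refine (stalkMap_comp (fst f g) f t _).trans
    (Eq.trans ?_ (stalkMap_comp (snd f g) g t _).symm)
  refine (stalkMap_fst t _).trans (Eq.trans ?_ (stalkMap_snd t _).symm)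
  refine congrArg _ ((Amalg.condition (toFst (pt t)) (toSnd (pt t)) (S.germ U _ h s)).trans ?_)
  exact congrArg (fun z => Amalg.inr _ _ (stalkMap g _ z)) (S.sp_germ _ U h s)

/-- Sections of the fiber product are locally products of pullbacks from the two factors, so the
components of a morphism determine its stalk maps. -/
theorem hom_ext_fst_snd {W : LMS.{u}} {m m' : W ⟶ obj f g} (h₁ : m ≫ fst f g = m' ≫ fst f g)
    (h₂ : m ≫ snd f g = m' ≫ snd f g) : m = m' := by
  have hb : ∀ x, map m x = map m' x := fun x =>
    ptExt (congrArg (fun k => map k x) h₁) (congrArg (fun k => map k x) h₂)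
  refine hom_ext hb fun U s x h h' => ?_
  obtain ⟨N, hN, i, V, V', a, b, H⟩ := exists_pair' s h
  obtain ⟨k₁, k₂, e⟩ := H _ hN
  obtain ⟨k₁', k₂', e'⟩ := H (map m' x) (hb x ▸ hN)
  rw [e, e', map_mul, map_mul, ← stalkMap_comp, ← stalkMap_comp, ← stalkMap_comp,
    ← stalkMap_comp]
  exact congrArg₂ (· * ·) (stalkMap_germ_congr h₁ x V k₁ k₁' a)
    (stalkMap_germ_congr h₂ x V' k₂ k₂' b)

section Lift

variable {W : LMS.{u}} (a : W ⟶ X) (b : W ⟶ Y) (w : a ≫ f = b ≫ g)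

/-- The map on points of the morphism to the fiber product. -/
def liftPt : C(W.obj, (obj f g).obj) where
  toFun x := ofPt ⟨(map a x, map b x), congrArg (fun k => map k x) w⟩
  continuous_toFun := continuous_ofPt.comp
    (Continuous.subtype_mk ((continuous_map a).prodMk (continuous_map b)) _)

/-- The map on stalks of the morphism to the fiber product. -/
def liftFib (x : W.obj) : Fib (pt (liftPt a b w x)) →* W.stalk x :=
  Amalg.lift (stalkMap a x) (stalkMap b x) (fun q => (stalkMap_comp a f x q).symm.trans
    ((stalkMap_congr w x (specializes_of_eq (congrArg (fun k => map k x) w).symm) q).trans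
      (stalkMap_comp b g x _)))

/-- The morphism to the fiber product. -/
def lift : W ⟶ obj f g :=
  homOfStalk (liftPt a b w) (fun x => (liftFib a b w x).comp (ev (liftPt a b w x)))
    (fun U s x hx => by
      obtain ⟨N, hN, i, V, V', c, d, H⟩ := exists_pair s hx
      obtain ⟨k₁, k₂, -⟩ := H _ hN
      refine ⟨(preimage a V ⊓ preimage b V') ⊓ N.comap (liftPt a b w), ⟨⟨k₁, k₂⟩, hN⟩,
        W.res inf_le_left (W.res inf_le_left (pull a V c) * W.res inf_le_right (pull b V' d)),
        fun y hy hU => ?_⟩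
      obtain ⟨l₁, l₂, e⟩ := H (liftPt a b w y) hy.2
      rw [germ_res, map_mul, germ_res, germ_res, MonoidHom.comp_apply]
      refine Eq.trans ?_ (congrArg (liftFib a b w y) e).symm
      exact congrArg₂ (· * ·) (stalkMap_germ a V y l₁ c).symm (stalkMap_germ b V' y l₂ d).symm)
    (fun x z hz => by
      obtain ⟨V, V', c, d, h, rfl⟩ := exists_germ_pairSec z
      have h₁ := mem_box.1 h
      rw [MonoidHom.comp_apply, ev_germ_pairSec c d _ h h₁.1 h₁.2] at hz
      -- The image of a pair is a product, so it is a unit only if both factors are; locality of `a`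
      -- and `b` then makes the pair itself invertible.
      have hz' : IsUnit (stalkMap a x (X.germ V _ h₁.1 c) * stalkMap b x (Y.germ V' _ h₁.2 d)) := hz
      have hz'' := IsUnit.mul_iff.1 hz'
      rw [stalkEquiv_germ_pairSec c d _ h h₁.1 h₁.2, isUnit_stalkEquiv_symm]
      exact (Prod.isUnit_iff.2 ⟨(isUnit_stalkMap_iff a x _).1 hz''.1,
        (isUnit_stalkMap_iff b x _).1 hz''.2⟩).map (Amalg.mk _ _))

theorem stalkMap_lift (x : W.obj) (z : (obj f g).stalk (map (lift a b w) x)) :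
    stalkMap (lift a b w) x z = liftFib a b w x (ev (liftPt a b w x) z) :=
  stalkMap_homOfStalk _ _ _ _ x z

theorem lift_fst : lift a b w ≫ fst f g = a := by
  refine hom_ext (fun x => rfl) fun U s x h h' => ?_
  refine (stalkMap_comp (lift a b w) (fst f g) x _).trans ?_
  refine (stalkMap_lift a b w x _).trans ?_
  have h1 := stalkMap_fst (map (lift a b w) x) (X.germ U _ h s)
  have h2 := (MulEquiv.eq_symm_apply (stalkEquiv (map (lift a b w) x))).1 h1
  exact (congrArg (liftFib a b w x) h2).trans (Amalg.lift_inl _ _ _ _)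

theorem lift_snd : lift a b w ≫ snd f g = b := by
  refine hom_ext (fun x => rfl) fun U s x h h' => ?_
  refine (stalkMap_comp (lift a b w) (snd f g) x _).trans ?_
  refine (stalkMap_lift a b w x _).trans ?_
  have h1 := stalkMap_snd (map (lift a b w) x) (Y.germ U _ h s)
  have h2 := (MulEquiv.eq_symm_apply (stalkEquiv (map (lift a b w) x))).1 h1
  exact (congrArg (liftFib a b w x) h2).trans (Amalg.lift_inr _ _ _ _)

end Lift

theorem isPullback : IsPullback (fst f g) (snd f g) f g :=
  ⟨⟨condition⟩, ⟨PullbackCone.IsLimit.mk _ (fun s => lift s.fst s.snd s.condition)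
    (fun _ => lift_fst _ _ _) (fun _ => lift_snd _ _ _) (fun _ _ h₁ h₂ =>
      hom_ext_fst_snd (h₁.trans (lift_fst _ _ _).symm) (h₂.trans (lift_snd _ _ _).symm))⟩⟩

end Universal

end Pb

/-! ## Descent along open surjective morphisms with flat stalk maps -/

/-! ### Invariance of flat local homomorphisms under isomorphism -/

section IsFlatLocal

variable {Q P R : Type*} [CommMonoid Q] [CommMonoid P] [CommMonoid R]

theorem IsFlatLocal.mulEquiv_comp {h : Q →* P} (H : IsFlatLocal h) (e : P ≃* R) :
    IsFlatLocal (e.toMonoidHom.comp h) where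
  exists_factor q q' p p' w := by
    have w' : h q * e.symm p = h q' * e.symm p' := e.injective (by simpa using w)
    obtain ⟨c, r, r', h1, h2, h3⟩ := H.exists_factor q q' _ _ w'
    exact ⟨e c, r, r', e.symm.injective (by simpa using h1), e.symm.injective (by simpa using h2),
      h3⟩
  exists_equalize q q' p w := by
    have w' : h q * e.symm p = h q' * e.symm p := e.injective (by simpa using w)
    obtain ⟨c, r, h1, h2⟩ := H.exists_equalize q q' _ w'
    exact ⟨e c, r, e.symm.injective (by simpa using h1), h2⟩
  isUnit_of_map q hq := H.isUnit_of_map q (by simpa using hq.map e.symm)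

theorem IsFlatLocal.comp_mulEquiv {h : Q →* P} (H : IsFlatLocal h) (e : R ≃* Q) :
    IsFlatLocal (h.comp e.toMonoidHom) where
  exists_factor q q' p p' w := by
    obtain ⟨c, r, r', h1, h2, h3⟩ := H.exists_factor (e q) (e q') p p' w
    exact ⟨c, e.symm r, e.symm r', by simpa using h1, by simpa using h2,
      e.injective (by simpa using h3)⟩
  exists_equalize q q' p w := by
    obtain ⟨c, r, h1, h2⟩ := H.exists_equalize (e q) (e q') p w
    exact ⟨c, e.symm r, by simpa using h1, e.injective (by simpa using h2)⟩
  isUnit_of_map q hq := (MulEquiv.isUnit_map e).1 (H.isUnit_of_map (e q) hq)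

end IsFlatLocal

open LMS

/-- An open surjective morphism whose stalk maps are flat. -/
structure IsOpenFlatCover {X Y : LMS.{u}} (p : X ⟶ Y) : Prop where
  isOpenMap : IsOpenMap (map p)
  surjective : Function.Surjective (map p)
  isFlatLocal : ∀ x, IsFlatLocal (stalkMap p x)

namespace IsOpenFlatCover

/-! ### Base change of open flat covers -/

section BaseChange

variable {X Y S : LMS.{u}} {f : X ⟶ S} (hf : IsOpenFlatCover f) (g : Y ⟶ S)
include hf

theorem snd : IsOpenFlatCover (Pb.snd f g) where
  isOpenMap U hU := by
    refine isOpen_iff_forall_mem_open.2 ?_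
    rintro _ ⟨t, ht, rfl⟩
    obtain ⟨V, W, h, h'⟩ := Pb.exists_box_le (f := f) (g := g) (U := ⟨U, hU⟩) (t := t) ht
    -- This set is the image of `box V W` under the second projection; it is open because `f` is.
    refine ⟨W ∩ map g ⁻¹' (map f '' V), ?_,
      W.2.inter ((hf.isOpenMap V V.2).preimage (continuous_map g)),
      (Pb.mem_box.1 h).2, _, (Pb.mem_box.1 h).1, Pb.condPt t⟩
    rintro y ⟨hy, x, hx, e⟩
    exact ⟨Pb.ofPt ⟨(x, y), e⟩, h' (Pb.mem_box.2 ⟨hx, hy⟩), rfl⟩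
  surjective y := by
    obtain ⟨x, hx⟩ := hf.surjective (map g y)
    exact ⟨Pb.ofPt ⟨(x, y), hx⟩, rfl⟩
  isFlatLocal t := by
    have H : IsFlatLocal (Pb.toFst (Pb.pt t)) := hf.isFlatLocal (Pb.pt t).1.1
    have := (H.inr (Pb.toSnd (Pb.pt t))).mulEquiv_comp (Pb.stalkEquiv t).symm
    have e : stalkMap (Pb.snd f g) t =
        (Pb.stalkEquiv t).symm.toMonoidHom.comp (Amalg.inr _ _) :=
      MonoidHom.ext (Pb.stalkMap_snd t)
    rw [e]
    exact this

end BaseChange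

/-! ### Descent of morphisms along an open flat cover -/

section Descent

variable {X Y Z : LMS.{u}} {p : X ⟶ Y} (hp : IsOpenFlatCover p)

include hp in
theorem eq_of_comp_eq {g g' : Y ⟶ Z} (h : p ≫ g = p ≫ g') : g = g' := by
  refine hom_ext (fun y => ?_) fun U s y h₁ h₂ => ?_
  · obtain ⟨x, rfl⟩ := hp.surjective y
    exact congrArg (fun k => map k x) h
  · obtain ⟨x, rfl⟩ := hp.surjective y
    refine (hp.isFlatLocal x).injective ?_
    exact (stalkMap_comp p g x _).symm.trans
      ((stalkMap_germ_congr h x U h₁ h₂ s).trans (stalkMap_comp p g' x _))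

variable {f : X ⟶ Z} (hf : Pb.fst p p ≫ f = Pb.snd p p ≫ f)
include hf

omit hp in
theorem map_eq_of_map_eq {x x' : X.obj} (e : map p x = map p x') : map f x = map f x' :=
  congrArg (fun k => map k (Pb.ofPt ⟨(x, x'), e⟩)) hf

omit hp in
-- The hypothesis `hf` read in the stalk of the kernel pair at `t`, that is, in the amalgamated sum.
theorem inl_eq_inr (t : Pb.Pt p p) {U : Opens Z.obj} (s : Z.Sec U) (h : map f t.1.1 ∈ U)
    (h' : map f t.1.2 ∈ U) :
    Amalg.inl (Pb.toFst t) (Pb.toSnd t) (stalkMap f _ (Z.germ U _ h s)) =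
      Amalg.inr (Pb.toFst t) (Pb.toSnd t) (stalkMap f _ (Z.germ U _ h' s)) := by
  have e := stalkMap_germ_congr hf (Pb.ofPt t) U h h' s
  have e₁ := (stalkMap_comp (Pb.fst p p) f (Pb.ofPt t) (Z.germ U _ h s)).trans
    (Pb.stalkMap_fst (Pb.ofPt t) _)
  have e₂ := (stalkMap_comp (Pb.snd p p) f (Pb.ofPt t) (Z.germ U _ h' s)).trans
    (Pb.stalkMap_snd (Pb.ofPt t) _)
  exact (Pb.stalkEquiv (Pb.ofPt t)).symm.injective (e₁.symm.trans (e.trans e₂))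

include hp in
-- At the diagonal point `(x, x)` the stalk is the amalgamated sum of `stalkMap p x` with itself, so
-- the equalizer property of flat local homomorphisms applies.
theorem exists_stalkMap_eq (x : X.obj) (a : Z.stalk (map f x)) :
    ∃ q, stalkMap p x q = stalkMap f x a := by
  obtain ⟨U, hU, s, rfl⟩ := Z.exists_germ_eq a
  have e := inl_eq_inr hf ⟨(x, x), rfl⟩ s hU hU
  have e' : Pb.toSnd (f := p) (g := p) ⟨(x, x), rfl⟩ = stalkMap p x :=
    MonoidHom.ext fun q => congrArg (stalkMap p x) (Y.sp_self _ q)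
  rw [e'] at e
  exact (hp.isFlatLocal x).exists_preimage e

include hp in
-- A descended germ found at one point of a fiber of `p` is correct at every other point of it. The
-- two candidates agree in the stalk at `(x, x')`, into which the stalk at `x'` injects because
-- flatness is stable under base change.
theorem stalkMap_sp_eq {x x' : X.obj} (e : map p x = map p x') {U : Opens Z.obj} (s : Z.Sec U)
    (h : map f x ∈ U) (h' : map f x' ∈ U) {q : Y.stalk (map p x)}
    (hq : stalkMap p x q = stalkMap f x (Z.germ U _ h s)) :
    stalkMap p x' (Y.sp (specializes_of_eq e.symm) q) = stalkMap f x' (Z.germ U _ h' s) := by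
  have H : IsFlatLocal (Pb.toFst (f := p) (g := p) ⟨(x, x'), e⟩) := hp.isFlatLocal x
  refine (H.inr (Pb.toSnd (f := p) (g := p) ⟨(x, x'), e⟩)).injective ?_
  have e₁ := inl_eq_inr hf ⟨(x, x'), e⟩ s h h'
  exact (Amalg.condition _ _ q).symm.trans ((congrArg (Amalg.inl _ _) hq).trans e₁)

include hp in
/-- Morphisms descend along open flat covers. -/
theorem exists_comp_eq : ∃ g : Y ⟶ Z, p ≫ g = f := by
  -- An arbitrary section on points, not continuous in general. It only fixes where each stalk map
  -- is defined; `key` removes the dependence on it.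
  choose σ hσ using hp.surjective
  have hb : ∀ x, map f (σ (map p x)) = map f x := fun x => map_eq_of_map_eq hf (hσ _)
  -- Continuity can be tested after composing with `p`, since an open continuous surjection is a
  -- quotient map.
  let b : C(Y.obj, Z.obj) := ⟨fun y => map f (σ y), by
    rw [(hp.isOpenMap.isQuotientMap (continuous_map p) hp.surjective).continuous_iff]
    exact (continuous_map f).congr fun x => (hb x).symm⟩
  let j : ∀ y, Y.stalk y →* X.stalk (σ y) := fun y =>
    (stalkMap p (σ y)).comp (Y.sp (specializes_of_eq (hσ y)))
  have hj : ∀ y, Function.Injective (j y) := fun y =>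
    (hp.isFlatLocal (σ y)).injective.comp (fun a a' e => by
      have := congrArg (Y.sp (specializes_of_eq (hσ y).symm)) e
      rwa [Y.sp_sp _ _ (specializes_refl _), Y.sp_sp _ _ (specializes_refl _), Y.sp_self,
        Y.sp_self] at this)
  have hex : ∀ y (a : Z.stalk (b y)), ∃ q, j y q = stalkMap f (σ y) a := fun y a => by
    obtain ⟨q, hq⟩ := exists_stalkMap_eq hp hf (σ y) a
    refine ⟨Y.sp (specializes_of_eq (hσ y).symm) q, ?_⟩
    change stalkMap p (σ y) (Y.sp _ (Y.sp _ q)) = _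
    rw [Y.sp_sp _ _ (specializes_refl _), Y.sp_self, hq]
  choose ψ₀ hψ₀ using hex
  let ψ : ∀ y, Z.stalk (b y) →* Y.stalk y := fun y =>
    { toFun := ψ₀ y
      map_one' := hj y (by rw [hψ₀, map_one, map_one])
      map_mul' := fun a a' => hj y (by rw [hψ₀, map_mul, map_mul, hψ₀, hψ₀]) }
  have key : ∀ (x : X.obj) (U : Opens Z.obj) (s : Z.Sec U) (h : map f x ∈ U)
      (h' : b (map p x) ∈ U), stalkMap p x (ψ (map p x) (Z.germ U _ h' s)) =
        stalkMap f x (Z.germ U _ h s) := fun x U s h h' => by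
    obtain ⟨q, hq⟩ := exists_stalkMap_eq hp hf x (Z.germ U _ h s)
    have e := stalkMap_sp_eq hp hf (hσ (map p x)).symm s h h' hq
    have e' : ψ (map p x) (Z.germ U _ h' s) = q := hj _ ((hψ₀ _ _).trans e.symm)
    rw [e', hq]
  have hφ : ∀ (U : Opens Z.obj) (s : Z.Sec U) (y : Y.obj) (_ : b y ∈ U),
      ∃ (W : Opens Y.obj) (_ : y ∈ W) (t : Y.Sec W),
        ∀ y' (hW : y' ∈ W) (hU : b y' ∈ U), Y.germ W y' hW t = ψ y' (Z.germ U _ hU s) := by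
    intro U s y hy
    obtain ⟨x, rfl⟩ := hp.surjective y
    obtain ⟨W, hW, t, ht⟩ := Y.exists_germ_eq (ψ (map p x) (Z.germ U _ hy s))
    have hx : map f x ∈ U := by
      rw [← hb x]
      exact hy
    have e : stalkMap p x (Y.germ W _ hW t) = stalkMap f x (Z.germ U _ hx s) := by
      rw [ht, key x U s hx hy]
    rw [stalkMap_germ, stalkMap_germ] at e
    obtain ⟨N, hN, i, i', H⟩ := X.exists_germ_eq_near _ _ e
    -- The pullbacks of `t` and `s` agree on the neighborhood `N` of `x`. As `p` is open, `p(N)` is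
    -- a neighborhood of `map p x`, and injectivity of the stalk maps at points of `N` carries the
    -- agreement down to it.
    let N' : Opens Y.obj := ⟨map p '' N, hp.isOpenMap N N.2⟩
    have hle : W ⊓ N' ≤ W := inf_le_left
    refine ⟨W ⊓ N', ⟨hW, x, hN, rfl⟩, Y.res hle t, ?_⟩
    intro y' hy' hU
    rw [germ_res]
    obtain ⟨n, hn, rfl⟩ := hy'.2
    have hnU : map f n ∈ U := i' hn
    refine (hp.isFlatLocal n).injective ?_
    rw [key n U s hnU hU, stalkMap_germ, stalkMap_germ]
    exact H n hn
  refine ⟨homOfStalk b ψ hφ (fun y a ha => ?_), ?_⟩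
  · have : IsUnit (j y (ψ y a)) := ha.map (j y)
    have h2 : j y (ψ y a) = stalkMap f (σ y) a := hψ₀ y a
    rw [h2] at this
    exact (isUnit_stalkMap_iff f (σ y) a).1 this
  · refine hom_ext hb fun U s x h h' => ?_
    refine (stalkMap_comp p _ x _).trans ?_
    refine (congrArg (stalkMap p x) (stalkMap_homOfStalk b ψ hφ _ (map p x) _)).trans ?_
    exact key x U s h' h

end Descent

end IsOpenFlatCover

/-! ## Stalks of spectra -/

namespace SpecStalk

open LMS

section Const

variable {P : CommMonCat.{u}}

/-- An element of `P`, as a global section of `Spec P`. -/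
def const : P →* (Spec P).Sec ⊤ where
  toFun a := (⟨fun F => Localization.mk a 1, fun F => ⟨⊤, trivial, 𝟙 _, a, 1, fun _ =>
    ⟨one_mem _, rfl⟩⟩⟩ : sections P ⊤)
  map_one' := Subtype.ext (funext fun _ => Localization.mk_one)
  map_mul' a b := Subtype.ext (funext fun _ => by
    refine Eq.trans ?_ (Localization.mk_mul a b 1 1).symm
    rw [mul_one])

/-- A point of the spectrum, as a face. -/
def face (F : (Spec P).obj) : Face P := F

/-- A face, as a point of the spectrum. -/
def ofFace (F : Face P) : (Spec P).obj := F

theorem face_ext {F G : (Spec P).obj} (h : ∀ a, a ∈ (face F).toSubmonoid ↔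
    a ∈ (face G).toSubmonoid) : F = G := by
  obtain ⟨⟨⟨s, h₁⟩, h₂⟩, h₃⟩ := F
  obtain ⟨⟨⟨t, k₁⟩, k₂⟩, k₃⟩ := G
  obtain rfl : s = t := Set.ext h
  rfl

/-- The localization map to the stalk at a point. -/
def toStalk (F : (Spec P).obj) : P →* (Spec P).stalk F := ((Spec P).germ ⊤ F trivial).comp const

/-- The value of a germ in the localization. -/
def ev (F : (Spec P).obj) : (Spec P).stalk F →* Localization (face F).toSubmonoid :=
  (evalStalk F).hom

theorem ev_toStalk (F : (Spec P).obj) (a : P) : ev F (toStalk F a) = Localization.mk a 1 :=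
  evalStalk_germ (P := P) F ⊤ trivial _

/-- Sections are locally fractions. -/
theorem exists_fraction {U : Opens (Spec P).obj} (s : (Spec P).Sec U) {F : (Spec P).obj}
    (hF : F ∈ U) :
    ∃ (N : Opens (Spec P).obj) (_ : F ∈ N) (h : N ≤ U) (a b : P), ∀ G (hG : G ∈ N),
      b ∈ (face G).toSubmonoid ∧ (Spec P).germ U G (h hG) s * toStalk G b = toStalk G a := by
  obtain ⟨N, hN, i, a, b, H⟩ := s.2 ⟨F, hF⟩
  refine ⟨N, hN, i.le, a, b, fun G hG => ⟨(H ⟨G, hG⟩).choose, ?_⟩⟩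
  let N' : Opens (Spec P).obj := N
  have hle : N' ≤ U := i.le
  have e : (Spec P).res hle s * (Spec P).res le_top (const b) =
      ((Spec P).res le_top (const a) : (Spec P).Sec N') := by
    refine Subtype.ext (funext fun G => ?_)
    obtain ⟨hb, h⟩ := H G
    refine (congrArg (· * Localization.mk b 1) h).trans ?_
    rw [Localization.mk_mul]
    change _ = Localization.mk a 1
    rw [Localization.mk_eq_mk_iff, Localization.r_iff_exists]
    exact ⟨1, by simp [mul_comm]⟩
  have hG' : G ∈ N' := hG
  have e' := congrArg ((Spec P).germ N' G hG') e
  rw [map_mul, germ_res, germ_res, germ_res] at e'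
  exact e'

theorem isUnit_toStalk_iff (F : (Spec P).obj) (a : P) :
    IsUnit (toStalk F a) ↔ a ∈ (face F).toSubmonoid := by
  constructor
  · intro h
    have h' := h.map (ev F)
    rw [ev_toStalk] at h'
    exact isUnit_mk (face F) a 1 h'
  · intro h
    exact isUnit_germ (P := P) F ⊤ trivial _ a 1 h (fun G => ⟨one_mem _, rfl⟩)

theorem exists_mul_eq {F : (Spec P).obj} (z : (Spec P).stalk F) :
    ∃ a b, b ∈ (face F).toSubmonoid ∧ z * toStalk F b = toStalk F a := by
  obtain ⟨U, hU, s, rfl⟩ := (Spec P).exists_germ_eq z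
  obtain ⟨N, hN, h, a, b, H⟩ := exists_fraction s hU
  exact ⟨a, b, H F hN⟩

theorem exists_of_toStalk_eq {F : (Spec P).obj} {a a' : P} (h : toStalk F a = toStalk F a') :
    ∃ c ∈ (face F).toSubmonoid, c * a = c * a' := by
  have h' := congrArg (ev F) h
  rw [ev_toStalk, ev_toStalk, Localization.mk_eq_mk_iff,
    Localization.r_iff_exists] at h'
  obtain ⟨c, hc⟩ := h'
  exact ⟨c, c.2, by simpa using hc⟩

theorem toStalk_eq_of_mul_eq {F : (Spec P).obj} {a a' c : P} (hc : c ∈ (face F).toSubmonoid)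
    (h : c * a = c * a') : toStalk F a = toStalk F a' := by
  refine ((isUnit_toStalk_iff F c).2 hc).mul_left_cancel ?_
  rw [← map_mul, h, map_mul]

theorem sp_toStalk {F G : (Spec P).obj} (h : G ⤳ F) (a : P) :
    (Spec P).sp h (toStalk F a) = toStalk G a := (Spec P).sp_germ h ⊤ trivial _

theorem specializes_iff {F G : (Spec P).obj} :
    G ⤳ F ↔ ∀ a ∈ (face F).toSubmonoid, a ∈ (face G).toSubmonoid := by
  rw [specializes_iff_forall_open]
  constructor
  · intro h a ha
    exact h _ (isOpen_basicOpenSet a) ha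
  · intro h s hs
    induction hs with
    | basic s hs =>
      obtain ⟨a, rfl⟩ := hs
      exact h a
    | univ => exact fun _ => trivial
    | inter s t _ _ h₁ h₂ => exact fun hF => ⟨h₁ hF.1, h₂ hF.2⟩
    | sUnion S _ ih =>
      rintro ⟨t, ht, hF⟩
      exact ⟨t, ht, ih t ht hF⟩

/-- The basic open set of all faces containing an element. -/
def basic (p : P) : Opens (Spec P).obj := basicOpen p

theorem mem_basic {p : P} {F : (Spec P).obj} : F ∈ basic p ↔ p ∈ (face F).toSubmonoid := Iff.rfl

theorem ev_bijective (F : (Spec P).obj) : Function.Bijective (ev F) := by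
  constructor
  · intro z z' e
    obtain ⟨a, b, hb, h⟩ := exists_mul_eq z
    obtain ⟨a', b', hb', h'⟩ := exists_mul_eq z'
    have e' := congrArg (fun w => w * ev F (toStalk F (b * b'))) e
    simp only [← map_mul] at e'
    have h1 : z * toStalk F (b * b') = toStalk F (a * b') := by
      rw [map_mul, ← mul_assoc, h, map_mul]
    have h2 : z' * toStalk F (b * b') = toStalk F (a' * b) := by
      rw [mul_comm b, map_mul, ← mul_assoc, h', map_mul]
    rw [h1, h2, ev_toStalk, ev_toStalk, Localization.mk_eq_mk_iff,
      Localization.r_iff_exists] at e'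
    obtain ⟨c, hc⟩ := e'
    have h3 := toStalk_eq_of_mul_eq (F := F) (a := a * b') (a' := a' * b) c.2 (by simpa using hc)
    refine ((isUnit_toStalk_iff F (b * b')).2 (mul_mem hb hb')).mul_right_cancel ?_
    rw [h1, h2, h3]
  · intro y
    induction y using Localization.induction_on with | _ y
    obtain ⟨a, b⟩ := y
    obtain ⟨w, hw⟩ := ((isUnit_toStalk_iff F b.1).2 b.2).exists_right_inv
    refine ⟨toStalk F a * w, ?_⟩
    have hb : IsUnit (ev F (toStalk F b.1)) :=
      ((isUnit_toStalk_iff F b.1).2 b.2).map _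
    refine hb.mul_left_cancel ?_
    rw [← map_mul, mul_left_comm, hw, mul_one, ev_toStalk, ev_toStalk,
      Localization.mk_mul, Localization.mk_eq_mk_iff, Localization.r_iff_exists]
    exact ⟨1, by simp⟩

end Const

/-! ### Finite generation of faces and stalks -/

section FG

variable {P : Type u} [CommMonoid P] [hP : Monoid.FG P]

/-- When a product lies in a face, so do its factors; thus `F` is generated by those generators of
`P` that it contains. -/
theorem face_fg (F : Face P) : F.toSubmonoid.FG := by
  classical
  obtain ⟨S, hS⟩ := hP.fg_top
  refine ⟨S.filter (· ∈ F.toSubmonoid), le_antisymm (Submonoid.closure_le.2 fun a ha =>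
    (Finset.mem_filter.1 ha).2) fun a ha => ?_⟩
  have haS : a ∈ Submonoid.closure (S : Set P) := hS ▸ Submonoid.mem_top a
  induction haS using Submonoid.closure_induction with
  | mem x hx => exact Submonoid.subset_closure (Finset.mem_filter.2 ⟨hx, ha⟩)
  | one => exact one_mem _
  | mul x y _ _ hx hy =>
    obtain ⟨h₁, h₂⟩ := F.mem_of_mul_mem ha
    exact mul_mem (hx h₁) (hy h₂)

/-- A face of a finitely generated monoid is the smallest face containing some element. -/
theorem exists_generator (F : Face P) : ∃ p ∈ F.toSubmonoid, ∀ G : Face P,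
    p ∈ G.toSubmonoid → F.toSubmonoid ≤ G.toSubmonoid := by
  classical
  obtain ⟨S, hS⟩ := face_fg F
  -- A face containing the product of the generators of `F` contains each of them.
  refine ⟨∏ s ∈ S, s, prod_mem fun s hs => hS ▸ Submonoid.subset_closure hs, fun G hG => ?_⟩
  rw [← hS, Submonoid.closure_le]
  intro s hs
  rw [← Finset.mul_prod_erase S (fun s => s) hs] at hG
  exact (G.mem_of_mul_mem hG).1

theorem fg_stalk {P : CommMonCat.{u}} [Monoid.FG P] (F : (Spec P).obj) :
    Monoid.FG ((Spec P).stalk F) := by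
  have h : Monoid.FG (Localization (face F).toSubmonoid) := Localization.fg (face_fg (face F))
  let e := (MulEquiv.ofBijective (ev F) (ev_bijective F)).symm
  exact Monoid.fg_of_surjective e.toMonoidHom e.surjective

end FG

end SpecStalk

/-! ## Charts -/

open LMS

/-- The target of the map is the localization of the source at the elements which become
invertible. -/
structure IsLocAtUnits {A B : Type*} [CommMonoid A] [CommMonoid B] (φ : A →* B) : Prop where
  exists_mul_eq : ∀ z : B, ∃ a b, IsUnit (φ b) ∧ z * φ b = φ a
  exists_of_eq : ∀ a a' : A, φ a = φ a' → ∃ c, IsUnit (φ c) ∧ c * a = c * a'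

/-- An open neighborhood `U` of `x` looks like the spectrum of the stalk at `x`. -/
structure IsChart (X : LMS.{u}) (x : X.obj) (U : Opens X.obj) : Prop where
  mem : x ∈ U
  specializes : ∀ y ∈ U, y ⤳ x
  fg : Monoid.FG (X.stalk x)
  exists_point : ∀ F : Face (X.stalk x), ∃ y ∈ U, ∃ h : y ⤳ x,
    ∀ a, IsUnit (X.sp h a) ↔ a ∈ F.toSubmonoid
  specializes_of_le : ∀ y ∈ U, ∀ z ∈ U, ∀ (hy : y ⤳ x) (hz : z ⤳ x),
    (∀ a, IsUnit (X.sp hy a) → IsUnit (X.sp hz a)) → z ⤳ y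
  eq_of_iff : ∀ y ∈ U, ∀ z ∈ U, ∀ (hy : y ⤳ x) (hz : z ⤳ x),
    (∀ a, IsUnit (X.sp hy a) ↔ IsUnit (X.sp hz a)) → y = z
  isLocAtUnits : ∀ y ∈ U, ∀ h : y ⤳ x, IsLocAtUnits (X.sp h)

/-- For `p` generating the face `F`, the set `basic p` consists of the faces containing `F`, which
are the generizations of `F`. They correspond to the faces of the stalk, and the remaining
conditions follow by clearing denominators. -/
theorem isChart_spec (P : CommMonCat.{u}) [Monoid.FG P] (F : (Spec P).obj) :
    ∃ U, IsChart (Spec P) F U := by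
  open SpecStalk in
  obtain ⟨p, hp, hF⟩ := exists_generator (face F)
  have hle : ∀ G : (Spec P).obj, G ⤳ F → ∀ b ∈ (face F).toSubmonoid, IsUnit (toStalk G b) :=
    fun G h b hb => (isUnit_toStalk_iff G b).2 (specializes_iff.1 h b hb)
  have hU : ∀ G : (Spec P).obj, ∀ h : G ⤳ F, ∀ a,
      IsUnit ((Spec P).sp h (toStalk F a)) ↔ a ∈ (face G).toSubmonoid := fun G h a => by
    rw [sp_toStalk, isUnit_toStalk_iff]
  refine ⟨basic p, hp, fun G hG => specializes_iff.2 (hF (face G) hG), fg_stalk F, fun Φ => ?_,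
    fun G hG G' hG' h h' H => ?_, fun G hG G' hG' h h' H => ?_, fun G hG h => ⟨fun z => ?_, ?_⟩⟩
  · have hu : ∀ u, IsUnit u → u ∈ Φ.toSubmonoid := fun u hu => by
      obtain ⟨v, hv⟩ := hu.exists_right_inv
      exact (Φ.mem_of_mul_mem (by rw [hv]; exact one_mem _)).1
    -- The preimage of `Φ` in `P` contains `F`, since elements of `F` are invertible in the stalk.
    let G : (Spec P).obj := ofFace (Φ.comap (toStalk F))
    have hG : G ⤳ F := specializes_iff.2 fun a ha => hu _ ((isUnit_toStalk_iff F a).2 ha)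
    refine ⟨G, hu _ ((isUnit_toStalk_iff F p).2 hp), hG, fun z => ?_⟩
    obtain ⟨a, b, hb, e⟩ := exists_mul_eq z
    have h1 : IsUnit ((Spec P).sp hG z) ↔ IsUnit ((Spec P).sp hG (z * toStalk F b)) := by
      rw [map_mul, IsUnit.mul_iff, sp_toStalk]
      exact ⟨fun h => ⟨h, hle G hG b hb⟩, fun h => h.1⟩
    have h2 : z ∈ Φ.toSubmonoid ↔ z * toStalk F b ∈ Φ.toSubmonoid :=
      ⟨fun h => mul_mem h (hu _ ((isUnit_toStalk_iff F b).2 hb)), fun h => (Φ.mem_of_mul_mem h).1⟩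
    rw [h1, h2, e, hU]
    exact Iff.rfl
  · exact specializes_iff.2 fun a ha => (hU G' h' a).1 (H _ ((hU G h a).2 ha))
  · exact face_ext fun a => (hU G h a).symm.trans ((H _).trans (hU G' h' a))
  · obtain ⟨a, b, hb, e⟩ := exists_mul_eq z
    refine ⟨toStalk F a, toStalk F b, ?_, ?_⟩
    · rw [sp_toStalk]
      exact (isUnit_toStalk_iff G b).2 hb
    · rw [sp_toStalk, sp_toStalk, e]
  · intro z z' e
    obtain ⟨a, b, hb, h1⟩ := exists_mul_eq z
    obtain ⟨a', b', hb', h2⟩ := exists_mul_eq z'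
    have h3 : z * toStalk F (b * b') = toStalk F (a * b') := by
      rw [map_mul, ← mul_assoc, h1, map_mul]
    have h4 : z' * toStalk F (b * b') = toStalk F (a' * b) := by
      rw [mul_comm b, map_mul, ← mul_assoc, h2, map_mul]
    have h5 : toStalk G (a * b') = toStalk G (a' * b) := by
      rw [← sp_toStalk h, ← sp_toStalk h, ← h3, ← h4, map_mul, map_mul _ z', e]
    obtain ⟨c, hc, h6⟩ := exists_of_toStalk_eq h5
    refine ⟨toStalk F c, (hU G h c).2 hc, ?_⟩
    refine ((isUnit_toStalk_iff F (b * b')).2 (mul_mem hb hb')).mul_right_cancel ?_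
    rw [mul_assoc, mul_assoc, h3, h4, ← map_mul, h6, map_mul]

/-! ## Local isomorphisms -/

/-- An open embedding with bijective stalk maps. -/
structure IsOpenImm {X Y : LMS.{u}} (j : X ⟶ Y) : Prop where
  isOpenEmbedding : Topology.IsOpenEmbedding (map j)
  bijective : ∀ x, Function.Bijective (stalkMap j x)

namespace IsOpenImm

variable {X Y Z : LMS.{u}}

theorem comp {f : X ⟶ Y} {g : Y ⟶ Z} (hf : IsOpenImm f) (hg : IsOpenImm g) :
    IsOpenImm (f ≫ g) where
  isOpenEmbedding := hg.isOpenEmbedding.comp hf.isOpenEmbedding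
  bijective x := by
    have h : ⇑(stalkMap (f ≫ g) x) = ⇑(stalkMap f x) ∘ ⇑(stalkMap g (map f x)) :=
      funext fun a => stalkMap_comp f g x a
    rw [h]
    exact (hf.bijective x).comp (hg.bijective _)

theorem of_isIso (f : X ⟶ Y) [IsIso f] : IsOpenImm f where
  isOpenEmbedding := by
    let e : X.obj ≃ₜ Y.obj :=
      { toFun := map f
        invFun := map (inv f)
        left_inv := fun x => congrArg (fun k => map k x) (IsIso.hom_inv_id f)
        right_inv := fun x => congrArg (fun k => map k x) (IsIso.inv_hom_id f)
        continuous_toFun := continuous_map f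
        continuous_invFun := continuous_map (inv f) }
    exact e.isOpenEmbedding
  bijective x := by
    have h1 : IsIso ((wideSubcategoryInclusion localHoms ⋙
      SheafedSpace.forgetToPresheafedSpace).map f) := inferInstance
    have h2 : IsIso f.hom.hom := h1
    have h3 : IsIso (f.hom.hom.stalkMap x) := PresheafedSpace.stalkMap.isIso f.hom.hom x
    exact (ConcreteCategory.isIso_iff_bijective _).1 h3

theorem isIso {f : X ⟶ Y} (hf : IsOpenImm f) (hs : Function.Surjective (map f)) : IsIso f := by
  have h1 : ∀ x, IsIso (f.hom.hom.stalkMap x) := fun x =>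
    (ConcreteCategory.isIso_iff_bijective _).2 (hf.bijective x)
  have h2 : SheafedSpace.IsOpenImmersion f.hom :=
    SheafedSpace.IsOpenImmersion.of_stalk_iso f.hom hf.isOpenEmbedding
  have h3 : Epi f.hom.hom.base := (TopCat.epi_iff_surjective _).2 hs
  have h4 : IsIso f.hom := SheafedSpace.IsOpenImmersion.to_iso f.hom
  have h5 : localHoms (inv f.hom) := fun y => by
    have : IsIso (inv f.hom).hom := SheafedSpace.is_presheafedSpace_iso (inv f.hom)
    have h6 : IsIso ((inv f.hom).hom.stalkMap y) := PresheafedSpace.stalkMap.isIso _ y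
    refine ⟨fun a ha => ?_⟩
    have h7 := ha.map (inv ((inv f.hom).hom.stalkMap y)).hom
    have h8 := congrArg (fun k => k.hom a) (IsIso.hom_inv_id ((inv f.hom).hom.stalkMap y))
    exact (congrArg IsUnit h8).mp h7
  exact ⟨⟨⟨inv f.hom, h5⟩, WideSubcategory.hom_ext _ (IsIso.hom_inv_id f.hom),
    WideSubcategory.hom_ext _ (IsIso.inv_hom_id f.hom)⟩⟩

end IsOpenImm

/-- The inclusion of an open subset. -/
def ofRestrict (X : LMS.{u}) (U : Opens X.obj) : X.restrict U ⟶ X :=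
  ⟨X.obj.ofRestrict U.isOpenEmbedding, fun x => by
    have h6 : IsIso ((X.obj.ofRestrict U.isOpenEmbedding).hom.stalkMap x) :=
      PresheafedSpace.ofRestrict_stalkMap_isIso X.obj.toPresheafedSpace U.isOpenEmbedding x
    refine ⟨fun a ha => ?_⟩
    have h7 := ha.map (inv ((X.obj.ofRestrict U.isOpenEmbedding).hom.stalkMap x)).hom
    have h8 := congrArg (fun k => k.hom a)
      (IsIso.hom_inv_id ((X.obj.ofRestrict U.isOpenEmbedding).hom.stalkMap x))
    exact (congrArg IsUnit h8).mp h7⟩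

theorem isOpenImm_ofRestrict (X : LMS.{u}) (U : Opens X.obj) : IsOpenImm (ofRestrict X U) where
  isOpenEmbedding := U.isOpenEmbedding
  bijective x := (ConcreteCategory.isIso_iff_bijective _).1
    (PresheafedSpace.ofRestrict_stalkMap_isIso X.obj.toPresheafedSpace U.isOpenEmbedding x)

theorem range_ofRestrict (X : LMS.{u}) (U : Opens X.obj) (x : X.obj) :
    (∃ y, map (ofRestrict X U) y = x) ↔ x ∈ U :=
  ⟨fun ⟨y, hy⟩ => hy ▸ (show U from y).2, fun h => ⟨(⟨x, h⟩ : U), rfl⟩⟩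

/-! ## Transfer of charts -/

/-- A chart is described by specializations, stalks and cospecialization maps alone, and an open
immersion preserves and reflects all of these. -/
theorem IsChart.image {X Y : LMS.{u}} {j : X ⟶ Y} (hj : IsOpenImm j) {x : X.obj}
    {U : Opens X.obj} (h : IsChart X x U) :
    IsChart Y (map j x) ⟨map j '' U, hj.isOpenEmbedding.isOpenMap U U.2⟩ := by
  let e : ∀ x, Y.stalk (map j x) ≃* X.stalk x := fun x =>
    MulEquiv.ofBijective (stalkMap j x) (hj.bijective x)
  have he : ∀ {y : X.obj} (hy : y ⤳ x) (hy' : map j y ⤳ map j x) (a),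
      e y (Y.sp hy' a) = X.sp hy (e x a) := fun hy hy' a => stalkMap_sp j hy hy' a
  have hs : ∀ {y z : X.obj}, map j y ⤳ map j z ↔ y ⤳ z :=
    hj.isOpenEmbedding.isInducing.specializes_iff
  have hu : ∀ {y : X.obj} (hy : y ⤳ x) (hy' : map j y ⤳ map j x) (a),
      IsUnit (Y.sp hy' a) ↔ IsUnit (X.sp hy (e x a)) := fun hy hy' a => by
    rw [← he hy hy', MulEquiv.isUnit_map]
  refine ⟨⟨x, h.mem, rfl⟩, ?_, ?_, fun F => ?_, ?_, ?_, ?_⟩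
  · rintro _ ⟨y, hy, rfl⟩
    exact hs.2 (h.specializes y hy)
  · have := h.fg
    exact Monoid.fg_of_surjective (e x).symm.toMonoidHom (e x).symm.surjective
  · obtain ⟨y, hy, hyx, H⟩ := h.exists_point (F.comap (e x).symm.toMonoidHom)
    refine ⟨map j y, ⟨y, hy, rfl⟩, hs.2 hyx, fun a => ?_⟩
    rw [hu hyx, H]
    change (e x).symm (e x a) ∈ F.toSubmonoid ↔ _
    rw [MulEquiv.symm_apply_apply]
  · rintro _ ⟨y, hy, rfl⟩ _ ⟨z, hz, rfl⟩ hyx hzx H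
    refine hs.2 (h.specializes_of_le y hy z hz (hs.1 hyx) (hs.1 hzx) fun a ha => ?_)
    obtain ⟨b, rfl⟩ := (e x).surjective a
    exact (hu _ hzx b).1 (H b ((hu _ hyx b).2 ha))
  · rintro _ ⟨y, hy, rfl⟩ _ ⟨z, hz, rfl⟩ hyx hzx H
    refine congrArg _ (h.eq_of_iff y hy z hz (hs.1 hyx) (hs.1 hzx) fun a => ?_)
    obtain ⟨b, rfl⟩ := (e x).surjective a
    exact (hu _ hyx b).symm.trans ((H b).trans (hu _ hzx b))
  · rintro _ ⟨y, hy, rfl⟩ hyx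
    have H := h.isLocAtUnits y hy (hs.1 hyx)
    refine ⟨fun z => ?_, fun a a' w => ?_⟩
    · obtain ⟨a, b, hb, w⟩ := H.exists_mul_eq (e y z)
      refine ⟨(e x).symm a, (e x).symm b, ?_, ?_⟩
      · rw [hu (hs.1 hyx), MulEquiv.apply_symm_apply]
        exact hb
      · apply (e y).injective
        rw [map_mul, he (hs.1 hyx), he (hs.1 hyx), MulEquiv.apply_symm_apply,
          MulEquiv.apply_symm_apply, w]
    · obtain ⟨c, hc, w'⟩ := H.exists_of_eq (e x a) (e x a') (by
        rw [← he (hs.1 hyx) hyx, ← he (hs.1 hyx) hyx, w])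
      refine ⟨(e x).symm c, ?_, ?_⟩
      · rw [hu (hs.1 hyx), MulEquiv.apply_symm_apply]
        exact hc
      · apply (e x).injective
        rw [map_mul, map_mul, MulEquiv.apply_symm_apply, w']

theorem exists_isChart {X : LMS.{u}} (hX : isLocallyFiniteTypeFan X) (x : X.obj) :
    ∃ U, IsChart X x U := by
  obtain ⟨U, hU, P, hP, ⟨e⟩⟩ := hX x
  obtain ⟨y, rfl⟩ := (range_ofRestrict X U x).2 hU
  have hj : IsOpenImm (e.inv ≫ ofRestrict X U) :=
    (IsOpenImm.of_isIso e.inv).comp (isOpenImm_ofRestrict X U)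
  obtain ⟨V, hV⟩ := isChart_spec P (map e.hom y)
  have h := hV.image hj
  have hy : map e.inv (map e.hom y) = y := congrArg (fun k => map k y) e.hom_inv_id
  rw [map_comp, hy] at h
  exact ⟨_, h⟩

/-! ## Spaces with charts are locally finite type fans -/

namespace IsChart

variable {X : LMS.{u}} {x : X.obj} {U : Opens X.obj} (h : IsChart X x U)

/-- The point of the space underlying a point of an open subset. -/
def val (y : (X.restrict U).obj) : X.obj := map (ofRestrict X U) y

theorem val_mem (y : (X.restrict U).obj) : val y ∈ U := (range_ofRestrict X U _).1 ⟨y, rfl⟩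

theorem val_injective : Function.Injective (val : (X.restrict U).obj → X.obj) :=
  (isOpenImm_ofRestrict X U).isOpenEmbedding.injective

include h in
theorem spec (y : (X.restrict U).obj) : val y ⤳ x := h.specializes _ (val_mem y)

/-- The map from the stalk at `x` to the stalks of the open subset. -/
def toStalk (y : (X.restrict U).obj) : X.stalk x →* (X.restrict U).stalk y :=
  (stalkMap (ofRestrict X U) y).comp (X.sp (h.spec y))

theorem isUnit_toStalk_iff (y : (X.restrict U).obj) (a : X.stalk x) :
    IsUnit (h.toStalk y a) ↔ IsUnit (X.sp (h.spec y) a) := isUnit_stalkMap_iff _ y _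

include h in
-- All points of `U` specialize to `x`, so `U` lies in every open neighborhood of `x`. This is why
-- germs at `x` extend to all of `U`.
theorem mem_of_mem {V : Opens X.obj} (hV : x ∈ V) (y : (X.restrict U).obj) : val y ∈ V :=
  (h.spec y).mem_open V.2 hV

/-- Elements of the stalk at `x` are sections over `U`. -/
theorem exists_sec (a : X.stalk x) :
    ∃ s : (X.restrict U).Sec ⊤, ∀ y, (X.restrict U).germ ⊤ y (Opens.mem_top y) s = h.toStalk y a := by
  obtain ⟨V, hV, s, rfl⟩ := X.exists_germ_eq a
  have hle : (⊤ : Opens (X.restrict U).obj) ≤ preimage (ofRestrict X U) V :=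
    fun y _ => h.mem_of_mem hV y
  refine ⟨(X.restrict U).res hle (pull (ofRestrict X U) V s), fun y => ?_⟩
  rw [germ_res]
  refine (stalkMap_germ (ofRestrict X U) V y (h.mem_of_mem hV y) s).symm.trans ?_
  exact congrArg (stalkMap (ofRestrict X U) y) (X.sp_germ (h.spec y) V hV s).symm

/-- The elements of the stalk at `x` which are invertible at `y` form a face. -/
def faceAt (y : (X.restrict U).obj) : Face (X.stalk x) where
  toSubmonoid := (IsUnit.submonoid _).comap (h.toStalk y)
  mem_of_mul_mem := fun {a b} hab => by
    change IsUnit (h.toStalk y (a * b)) at hab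
    rw [map_mul, IsUnit.mul_iff] at hab
    exact hab

/-- The continuous map to the spectrum of the stalk. -/
def base : C((X.restrict U).obj, (Spec (X.stalk x)).obj) where
  toFun y := SpecStalk.ofFace (h.faceAt y)
  continuous_toFun := by
    refine continuous_generateFrom_iff.2 ?_
    rintro _ ⟨a, rfl⟩
    refine isOpen_iff_forall_mem_open.2 fun y hy => ?_
    have hy' : IsUnit (h.toStalk y a) := hy
    obtain ⟨s, hs⟩ := h.exists_sec a
    rw [← hs] at hy'
    obtain ⟨W, hW, hle, t, ht⟩ := (X.restrict U).exists_inv_near _ hy'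
    refine ⟨W, fun z hz => ?_, W.2, hW⟩
    have h1 := ht z hz
    have h2 : IsUnit (h.toStalk z a) := by
      rw [← hs]
      exact IsUnit.of_mul_eq_one _ h1
    exact h2

theorem mem_base (y : (X.restrict U).obj) (a : X.stalk x) :
    a ∈ (SpecStalk.face (h.base y)).toSubmonoid ↔ IsUnit (h.toStalk y a) := Iff.rfl

theorem base_injective : Function.Injective h.base := fun y z e =>
  val_injective (h.eq_of_iff _ (val_mem y) _ (val_mem z) (h.spec y) (h.spec z) fun a => by
    rw [← h.isUnit_toStalk_iff, ← h.isUnit_toStalk_iff, ← h.mem_base, ← h.mem_base, e])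

theorem base_surjective : Function.Surjective h.base := fun F => by
  obtain ⟨y, hy, hyx, H⟩ := h.exists_point (SpecStalk.face F)
  obtain ⟨y, rfl⟩ := (range_ofRestrict X U y).2 hy
  refine ⟨y, SpecStalk.face_ext fun a => ?_⟩
  rw [h.mem_base, h.isUnit_toStalk_iff]
  exact H a

/-- The smallest neighborhood of `h.base y` already lies in the image: its points are `h.base z`
with `z ⤳ y`, and an open set containing `y` contains every such `z`. -/
theorem isOpenMap_base : IsOpenMap h.base := by
  intro W hW
  have := h.fg
  refine isOpen_iff_forall_mem_open.2 ?_
  rintro _ ⟨y, hy, rfl⟩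
  obtain ⟨p, hp, H⟩ := SpecStalk.exists_generator (SpecStalk.face (h.base y))
  refine ⟨SpecStalk.basic p, fun G hG => ?_, (SpecStalk.basic p).2, hp⟩
  obtain ⟨z, rfl⟩ := h.base_surjective G
  refine ⟨z, ?_, rfl⟩
  have hle := H _ (SpecStalk.mem_basic.1 hG)
  have hs : val z ⤳ val y := h.specializes_of_le _ (val_mem y) _ (val_mem z) (h.spec y) (h.spec z)
    fun a ha => (h.isUnit_toStalk_iff z a).1 (hle ((h.isUnit_toStalk_iff y a).2 ha))
  have hs' : z ⤳ y := (isOpenImm_ofRestrict X U).isOpenEmbedding.isInducing.specializes_iff.1 hs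
  exact hs'.mem_open hW hy

theorem isLocAtUnits_toStalk (y : (X.restrict U).obj) : IsLocAtUnits (h.toStalk y) := by
  have H := h.isLocAtUnits (val y) (val_mem y) (h.spec y)
  have hb := (isOpenImm_ofRestrict X U).bijective y
  refine ⟨fun z => ?_, fun a a' w => ?_⟩
  · obtain ⟨z, rfl⟩ := hb.2 z
    obtain ⟨a, b, hb, w⟩ := H.exists_mul_eq z
    exact ⟨a, b, (h.isUnit_toStalk_iff y b).2 hb, by
      rw [toStalk, MonoidHom.comp_apply, MonoidHom.comp_apply, ← map_mul]
      exact congrArg _ w⟩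
  · obtain ⟨c, hc, w'⟩ := H.exists_of_eq a a' (hb.1 w)
    exact ⟨c, (h.isUnit_toStalk_iff y c).2 hc, w'⟩

/-- The map on stalks of the isomorphism to the spectrum of the stalk. -/
def stalkHom (y : (X.restrict U).obj) :
    (Spec (X.stalk x)).stalk (h.base y) →* (X.restrict U).stalk y :=
  ((Localization.monoidOf (SpecStalk.face (h.base y)).toSubmonoid).lift
    (g := h.toStalk y) (fun b => (h.mem_base y b).1 b.2)).comp (SpecStalk.ev (h.base y))

theorem stalkHom_toStalk (y : (X.restrict U).obj) (a : X.stalk x) :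
    h.stalkHom y (SpecStalk.toStalk (h.base y) a) = h.toStalk y a := by
  rw [stalkHom, MonoidHom.comp_apply, SpecStalk.ev_toStalk, Localization.mk_one_eq_monoidOf_mk]
  exact Submonoid.LocalizationMap.lift_eq _ _ _

theorem isUnit_stalkHom (y : (X.restrict U).obj) (z) (hz : IsUnit (h.stalkHom y z)) :
    IsUnit z := by
  obtain ⟨a, b, hb, e⟩ := SpecStalk.exists_mul_eq z
  have hbu := (SpecStalk.isUnit_toStalk_iff _ b).2 hb
  have h1 : IsUnit (h.stalkHom y (z * SpecStalk.toStalk (h.base y) b)) := by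
    rw [map_mul]
    exact hz.mul (hbu.map _)
  rw [e, stalkHom_toStalk, ← mem_base, ← SpecStalk.isUnit_toStalk_iff, ← e] at h1
  exact isUnit_of_mul_isUnit_left h1

/-- Both stalks are localizations of `X.stalk x` at the same elements, those that become invertible
at `y`. -/
theorem stalkHom_bijective (y : (X.restrict U).obj) : Function.Bijective (h.stalkHom y) := by
  have H := h.isLocAtUnits_toStalk y
  constructor
  · intro z z' w
    obtain ⟨a, b, hb, h1⟩ := SpecStalk.exists_mul_eq z
    obtain ⟨a', b', hb', h2⟩ := SpecStalk.exists_mul_eq z'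
    have h3 : z * SpecStalk.toStalk _ (b * b') = SpecStalk.toStalk _ (a * b') := by
      rw [map_mul, ← mul_assoc, h1, map_mul]
    have h4 : z' * SpecStalk.toStalk _ (b * b') = SpecStalk.toStalk _ (a' * b) := by
      rw [mul_comm b, map_mul, ← mul_assoc, h2, map_mul]
    have h5 : h.toStalk y (a * b') = h.toStalk y (a' * b) := by
      rw [← stalkHom_toStalk, ← stalkHom_toStalk, ← h3, ← h4, map_mul, map_mul _ z', w]
    obtain ⟨c, hc, h6⟩ := H.exists_of_eq _ _ h5
    refine ((SpecStalk.isUnit_toStalk_iff _ (b * b')).2 (mul_mem hb hb')).mul_right_cancel ?_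
    rw [h3, h4]
    exact SpecStalk.toStalk_eq_of_mul_eq hc h6
  · intro z
    obtain ⟨a, b, hb, e⟩ := H.exists_mul_eq z
    obtain ⟨w, hw⟩ := ((SpecStalk.isUnit_toStalk_iff (h.base y) b).2 hb).exists_right_inv
    refine ⟨SpecStalk.toStalk _ a * w, hb.mul_right_cancel ?_⟩
    rw [e, ← stalkHom_toStalk, ← stalkHom_toStalk, ← map_mul, mul_assoc, mul_comm w, hw, mul_one]

/-- The morphism to the spectrum of the stalk. -/
def toSpec : X.restrict U ⟶ Spec (X.stalk x) :=
  homOfStalk h.base h.stalkHom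
    (fun V s y hy => by
      -- The section is locally a fraction `a / b`. Both `a` and `b` are sections over the whole
      -- chart and `b` is invertible at `y`, hence near `y`, so the pullback is `a` times a local
      -- inverse of `b`.
      obtain ⟨N, hN, hle, a, b, H⟩ := SpecStalk.exists_fraction s hy
      obtain ⟨sa, hsa⟩ := h.exists_sec a
      obtain ⟨sb, hsb⟩ := h.exists_sec b
      have hb : IsUnit ((X.restrict U).germ ⊤ y (Opens.mem_top y) sb) := by
        rw [hsb]
        exact (h.mem_base y b).1 (H _ hN).1
      obtain ⟨W, hW, hWt, t, ht⟩ := (X.restrict U).exists_inv_near _ hb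
      have hle' : W ⊓ N.comap h.base ≤ W := inf_le_left
      refine ⟨W ⊓ N.comap h.base, ⟨hW, hN⟩, (X.restrict U).res le_top sa *
        (X.restrict U).res hle' t, fun z hz hU => ?_⟩
      obtain ⟨hbz, e⟩ := H (h.base z) hz.2
      have e' := congrArg (h.stalkHom z) e
      rw [map_mul, stalkHom_toStalk, stalkHom_toStalk] at e'
      rw [map_mul, germ_res, germ_res, hsa, ← e', mul_assoc, ← hsb, ht z hz.1, mul_one])
    h.isUnit_stalkHom

theorem isIso_toSpec : IsIso h.toSpec := by
  refine IsOpenImm.isIso ⟨?_, fun y => ?_⟩ h.base_surjective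
  · exact .of_continuous_injective_isOpenMap h.base.continuous h.base_injective h.isOpenMap_base
  · have e : stalkMap h.toSpec y = h.stalkHom y :=
      MonoidHom.ext (stalkMap_homOfStalk h.base h.stalkHom _ h.isUnit_stalkHom y)
    rw [e]
    exact h.stalkHom_bijective y

end IsChart

theorem isLocallyFiniteTypeFan_of_isChart {X : LMS.{u}} (H : ∀ x, ∃ U, IsChart X x U) :
    isLocallyFiniteTypeFan X := fun x => by
  obtain ⟨U, h⟩ := H x
  have := h.isIso_toSpec
  exact ⟨U, h.mem, X.stalk x, h.fg, ⟨asIso h.toSpec⟩⟩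

/-! ## Charts of fiber products -/

section IsLocAtUnits

variable {Q P P' Q₁ P₁ P₁' : Type*} [CommMonoid Q] [CommMonoid P] [CommMonoid P'] [CommMonoid Q₁]
  [CommMonoid P₁] [CommMonoid P₁']

theorem IsLocAtUnits.exists_lift {φ : Q →* P} (H : IsLocAtUnits φ) (ρ : Q →* P')
    (hρ : ∀ q, IsUnit (φ q) → IsUnit (ρ q)) : ∃ r : P →* P', ∀ q, r (φ q) = ρ q := by
  let S : Submonoid Q := (IsUnit.submonoid P).comap φ
  let L : S.LocalizationMap P :=
    { φ with
      isLocalizationMap :=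
        { map_units := fun s => s.2
          surj := fun z => by
            obtain ⟨a, b, hb, e⟩ := H.exists_mul_eq z
            exact ⟨(a, ⟨b, hb⟩), e⟩
          exists_of_eq := fun {a a'} e => by
            obtain ⟨c, hc, e'⟩ := H.exists_of_eq a a' e
            exact ⟨⟨c, hc⟩, e'⟩ } }
  exact ⟨L.lift (g := ρ) fun s => hρ s s.2, fun q => L.lift_eq _ q⟩

/-- Amalgamated sums commute with localization. -/
theorem IsLocAtUnits.amalg {h : Q →* P} {k : Q →* P'} {h₁ : Q₁ →* P₁} {k₁ : Q₁ →* P₁'}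
    {φ : Q →* Q₁} {ψ : P →* P₁} {ψ' : P' →* P₁'} (Hφ : IsLocAtUnits φ) (Hψ : IsLocAtUnits ψ)
    (Hψ' : IsLocAtUnits ψ') (w : ∀ q, ψ (h q) = h₁ (φ q)) (w' : ∀ q, ψ' (k q) = k₁ (φ q))
    {Φ : Amalg h k →* Amalg h₁ k₁} (hl : ∀ p, Φ (Amalg.inl h k p) = Amalg.inl h₁ k₁ (ψ p))
    (hr : ∀ p, Φ (Amalg.inr h k p) = Amalg.inr h₁ k₁ (ψ' p)) : IsLocAtUnits Φ where
  exists_mul_eq z := by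
    obtain ⟨p, p', rfl⟩ := Amalg.exists_rep _ _ z
    obtain ⟨a, b, hb, e⟩ := Hψ.exists_mul_eq p
    obtain ⟨a', b', hb', e'⟩ := Hψ'.exists_mul_eq p'
    refine ⟨Amalg.inl h k a * Amalg.inr h k a', Amalg.inl h k b * Amalg.inr h k b', ?_, ?_⟩
    · rw [map_mul, hl, hr]
      exact (hb.map _).mul (hb'.map _)
    · rw [map_mul, map_mul, hl, hl, hr, hr, mul_mul_mul_comm, ← map_mul, ← map_mul, e, e']
  exists_of_eq z z' e := by
    -- Rather than analysing the congruence on `Amalg h₁ k₁`, factor the localization map `κ` at the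
    -- elements with invertible image as `R ∘ Φ`. Then `Φ z = Φ z'` implies `κ z = κ z'`, which is
    -- the claim.
    let S : Submonoid (Amalg h k) := (IsUnit.submonoid _).comap Φ
    let κ : Amalg h k →* Localization S := (Localization.monoidOf S).toMonoidHom
    have hκ : ∀ z, IsUnit (Φ z) → IsUnit (κ z) := fun z hz =>
      (Localization.monoidOf S).map_units ⟨z, hz⟩
    obtain ⟨r, hr₁⟩ := Hψ.exists_lift (κ.comp (Amalg.inl h k)) fun p hp =>
      hκ _ (by rw [hl]; exact hp.map _)
    obtain ⟨r', hr'₁⟩ := Hψ'.exists_lift (κ.comp (Amalg.inr h k)) fun p hp =>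
      hκ _ (by rw [hr]; exact hp.map _)
    have hrr : ∀ q, r (h₁ (φ q)) = r' (k₁ (φ q)) := fun q => by
      rw [← w, ← w', hr₁, hr'₁, MonoidHom.comp_apply, MonoidHom.comp_apply, Amalg.condition]
    -- Compatibility over `Q₁` is known on the image of `φ`; for general `q`, write `q * φ b = φ a`
    -- and cancel the unit coming from `φ b`.
    let R : Amalg h₁ k₁ →* Localization S := Amalg.lift r r' (fun q => by
      obtain ⟨a, b, hb, e⟩ := Hφ.exists_mul_eq q
      have h1 : IsUnit (r (h₁ (φ b))) := (hb.map h₁).map r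
      refine h1.mul_right_cancel ?_
      rw [← map_mul, ← map_mul, e, hrr a, ← e, map_mul, map_mul, hrr b])
    have hR : R.comp Φ = κ := Amalg.hom_ext
      (fun p => by rw [MonoidHom.comp_apply, hl, Amalg.lift_inl, hr₁]; rfl)
      (fun p => by rw [MonoidHom.comp_apply, hr, Amalg.lift_inr, hr'₁]; rfl)
    have e' : κ z = κ z' := by
      rw [← hR, MonoidHom.comp_apply, e, MonoidHom.comp_apply]
    obtain ⟨c, hc⟩ := (Localization.monoidOf S).exists_of_eq e'
    exact ⟨c, c.2, hc⟩

theorem IsLocAtUnits.of_conj {φ : Q →* P} (e : Q₁ ≃* Q) (e' : P ≃* P₁)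
    (H : IsLocAtUnits ((e'.toMonoidHom.comp φ).comp e.toMonoidHom)) : IsLocAtUnits φ where
  exists_mul_eq z := by
    obtain ⟨a, b, hb, w⟩ := H.exists_mul_eq (e' z)
    refine ⟨e a, e b, (MulEquiv.isUnit_map e').1 hb, e'.injective ?_⟩
    rw [map_mul]
    exact w
  exists_of_eq a a' w := by
    obtain ⟨c, hc, w'⟩ := H.exists_of_eq (e.symm a) (e.symm a') (by
      change e' (φ (e (e.symm a))) = e' (φ (e (e.symm a')))
      rw [e.apply_symm_apply, e.apply_symm_apply, w])
    refine ⟨e c, (MulEquiv.isUnit_map e').1 hc, e.symm.injective ?_⟩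
    rw [map_mul, map_mul, e.symm_apply_apply, w']

end IsLocAtUnits

namespace Pb

variable {X Y S : LMS.{u}} {f : X ⟶ S} {g : Y ⟶ S}

theorem specializes_of_fst_snd {t t' : (obj f g).obj} (h : (pt t).1.1 ⤳ (pt t').1.1)
    (h' : (pt t).1.2 ⤳ (pt t').1.2) : t ⤳ t' := by
  rw [specializes_iff_forall_open]
  intro O hO ht'
  obtain ⟨V, W, hb, hle⟩ := exists_box_le (U := ⟨O, hO⟩) ht'
  exact hle (mem_box.2 ⟨h.mem_open V.2 (mem_box.1 hb).1, h'.mem_open W.2 (mem_box.1 hb).2⟩)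

theorem fst_specializes {t t' : (obj f g).obj} (h : t ⤳ t') : (pt t).1.1 ⤳ (pt t').1.1 :=
  map_specializes (fst f g) h

theorem snd_specializes {t t' : (obj f g).obj} (h : t ⤳ t') : (pt t).1.2 ⤳ (pt t').1.2 :=
  map_specializes (snd f g) h

theorem exists_mul_stalkMap (t : (obj f g).obj) (z : (obj f g).stalk t) :
    ∃ a b, z = stalkMap (fst f g) t a * stalkMap (snd f g) t b := by
  obtain ⟨⟨a, b⟩, h⟩ := Amalg.mk_surjective _ _ (stalkEquiv t z)
  exact ⟨a, b, by rw [← stalkEquiv_symm_mk, h, MulEquiv.symm_apply_apply]⟩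

theorem stalkMap_toFst (t : (obj f g).obj) (q : S.stalk (map f (pt t).1.1)) :
    stalkMap (fst f g) t (toFst (pt t) q) = stalkMap (snd f g) t (toSnd (pt t) q) :=
  (stalkMap_fst t _).trans ((congrArg _ (Amalg.condition _ _ q)).trans (stalkMap_snd t _).symm)

theorem sp_toFst {t t' : (obj f g).obj} (h : t ⤳ t')
    (h' : map f (pt t).1.1 ⤳ map f (pt t').1.1) (q : S.stalk (map f (pt t').1.1)) :
    X.sp (fst_specializes h) (toFst (pt t') q) = toFst (pt t) (S.sp h' q) :=
  (stalkMap_sp f _ _ q).symm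

theorem sp_toSnd {t t' : (obj f g).obj} (h : t ⤳ t')
    (h' : map f (pt t).1.1 ⤳ map f (pt t').1.1) (q : S.stalk (map f (pt t').1.1)) :
    Y.sp (snd_specializes h) (toSnd (pt t') q) = toSnd (pt t) (S.sp h' q) := by
  have h₁ : map g (pt t').1.2 ⤳ map f (pt t').1.1 := specializes_of_eq (condPt t').symm
  have h₂ : map g (pt t).1.2 ⤳ map f (pt t).1.1 := specializes_of_eq (condPt t).symm
  have h₃ := map_specializes g (snd_specializes h)
  refine (stalkMap_sp g (snd_specializes h) h₃ (S.sp h₁ q)).symm.trans ?_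
  refine congrArg (stalkMap g (pt t).1.2) ?_
  rw [S.sp_sp h₃ h₁ (h₃.trans h₁), S.sp_sp h₂ h' (h₃.trans h₁)]

theorem isUnit_sp_stalkMap_fst {t t' : (obj f g).obj} (h : t ⤳ t')
    (h' : (pt t).1.1 ⤳ (pt t').1.1) (a : X.stalk (pt t').1.1) :
    IsUnit ((obj f g).sp h (stalkMap (fst f g) t' a)) ↔ IsUnit (X.sp h' a) :=
  (iff_of_eq (congrArg IsUnit (stalkMap_sp (fst f g) h h' a).symm)).trans
    (isUnit_stalkMap_iff (fst f g) t _)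

theorem isUnit_sp_stalkMap_snd {t t' : (obj f g).obj} (h : t ⤳ t')
    (h' : (pt t).1.2 ⤳ (pt t').1.2) (a : Y.stalk (pt t').1.2) :
    IsUnit ((obj f g).sp h (stalkMap (snd f g) t' a)) ↔ IsUnit (Y.sp h' a) :=
  (iff_of_eq (congrArg IsUnit (stalkMap_sp (snd f g) h h' a).symm)).trans
    (isUnit_stalkMap_iff (snd f g) t _)

/-- Under `stalkEquiv` the cospecialization map becomes the map of amalgamated sums induced by the
cospecialization maps of `S`, `X` and `Y`, so `IsLocAtUnits.amalg` applies. -/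
theorem isLocAtUnits_sp {t t' : (obj f g).obj} (h : t ⤳ t')
    (h' : map f (pt t).1.1 ⤳ map f (pt t').1.1) (hS : IsLocAtUnits (S.sp h'))
    (hX : IsLocAtUnits (X.sp (fst_specializes h))) (hY : IsLocAtUnits (Y.sp (snd_specializes h))) :
    IsLocAtUnits ((obj f g).sp h) := by
  refine .of_conj (stalkEquiv t').symm (stalkEquiv t) (.amalg hS hX hY (sp_toFst h h')
    (sp_toSnd h h') (fun a => ?_) (fun b => ?_))
  · change stalkEquiv t ((obj f g).sp h ((stalkEquiv t').symm _)) = _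
    rw [← stalkMap_fst, ← MulEquiv.eq_symm_apply, ← stalkMap_fst]
    exact (stalkMap_sp (fst f g) h (fst_specializes h) a).symm
  · change stalkEquiv t ((obj f g).sp h ((stalkEquiv t').symm _)) = _
    rw [← stalkMap_snd, ← MulEquiv.eq_symm_apply, ← stalkMap_snd]
    exact (stalkMap_sp (snd f g) h (snd_specializes h) b).symm

/-- The stalk at `t` is generated by the images of the stalks of `X` and `Y`, so a face of it, or
the invertibility of its elements, is controlled by the two factors. The chart of `S` serves to
match points of `X` and `Y` over the base. -/
theorem isChart {t : (obj f g).obj} {U : Opens X.obj} {V : Opens Y.obj} {W : Opens S.obj}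
    (hU : IsChart X (pt t).1.1 U) (hV : IsChart Y (pt t).1.2 V)
    (hW : IsChart S (map f (pt t).1.1) W) : IsChart (obj f g) t (box U V) := by
  have hfW : ∀ {x}, x ⤳ (pt t).1.1 → map f x ∈ W := fun h =>
    (map_specializes f h).mem_open W.2 hW.mem
  have hgS : ∀ {y}, y ⤳ (pt t).1.2 → map g y ⤳ map f (pt t).1.1 := fun h =>
    (map_specializes g h).trans (specializes_of_eq (condPt t).symm)
  refine ⟨mem_box.2 ⟨hU.mem, hV.mem⟩, fun t' h => specializes_of_fst_snd
    (hU.specializes _ (mem_box.1 h).1) (hV.specializes _ (mem_box.1 h).2), ?_, fun F => ?_, ?_, ?_,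
    ?_⟩
  · have h₁ := hU.fg
    have h₂ := hV.fg
    exact Monoid.fg_of_surjective (M := X.stalk (pt t).1.1 × Y.stalk (pt t).1.2)
      ((stalkEquiv t).symm.toMonoidHom.comp (Amalg.mk (toFst (pt t)) (toSnd (pt t))))
      ((stalkEquiv t).symm.surjective.comp (Amalg.mk_surjective _ _))
  · obtain ⟨x, hx, hxU, Hx⟩ := hU.exists_point (F.comap (stalkMap (fst f g) t))
    obtain ⟨y, hy, hyV, Hy⟩ := hV.exists_point (F.comap (stalkMap (snd f g) t))
    -- Both images lie in the chart `W` and define the same face of the stalk of `S`, namely the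
    -- preimage of `F`, because the two maps from that stalk to the stalk at `t` coincide.
    have hxy : map f x = map g y := by
      refine hW.eq_of_iff _ (hfW hxU) _ ((hgS hyV).mem_open W.2 hW.mem) (map_specializes f hxU)
        (hgS hyV) fun a => ?_
      have e₁ : IsUnit (S.sp (map_specializes f hxU) a) ↔
          stalkMap (fst f g) t (toFst (pt t) a) ∈ F.toSubmonoid := by
        rw [← isUnit_stalkMap_iff f x, stalkMap_sp f hxU]
        exact Hx _
      have e₂ : IsUnit (S.sp (hgS hyV) a) ↔
          stalkMap (snd f g) t (toSnd (pt t) a) ∈ F.toSubmonoid := by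
        rw [← S.sp_sp (map_specializes g hyV) (specializes_of_eq (condPt t).symm),
          ← isUnit_stalkMap_iff g y, stalkMap_sp g hyV]
        exact Hy _
      rw [e₁, e₂, stalkMap_toFst]
    have ht : ofPt ⟨(x, y), hxy⟩ ⤳ t := specializes_of_fst_snd hxU hyV
    refine ⟨ofPt ⟨(x, y), hxy⟩, mem_box.2 ⟨hx, hy⟩, ht, fun z => ?_⟩
    obtain ⟨a, b, rfl⟩ := exists_mul_stalkMap t z
    rw [map_mul, IsUnit.mul_iff]
    exact (and_congr ((isUnit_sp_stalkMap_fst ht hxU a).trans (Hx a))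
      ((isUnit_sp_stalkMap_snd ht hyV b).trans (Hy b))).trans
      ⟨fun h => mul_mem h.1 h.2, fun h => F.mem_of_mul_mem h⟩
  · intro t₁ h₁ t₂ h₂ ht₁ ht₂ H
    have k₁ := mem_box.1 h₁
    have k₂ := mem_box.1 h₂
    refine specializes_of_fst_snd
      (hU.specializes_of_le _ k₁.1 _ k₂.1 (fst_specializes ht₁) (fst_specializes ht₂) fun a ha => ?_)
      (hV.specializes_of_le _ k₁.2 _ k₂.2 (snd_specializes ht₁) (snd_specializes ht₂) fun a ha => ?_)
    · exact (isUnit_sp_stalkMap_fst ht₂ _ a).1 (H _ ((isUnit_sp_stalkMap_fst ht₁ _ a).2 ha))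
    · exact (isUnit_sp_stalkMap_snd ht₂ _ a).1 (H _ ((isUnit_sp_stalkMap_snd ht₁ _ a).2 ha))
  · intro t₁ h₁ t₂ h₂ ht₁ ht₂ H
    have k₁ := mem_box.1 h₁
    have k₂ := mem_box.1 h₂
    refine ptExt
      (hU.eq_of_iff _ k₁.1 _ k₂.1 (fst_specializes ht₁) (fst_specializes ht₂) fun a => ?_)
      (hV.eq_of_iff _ k₁.2 _ k₂.2 (snd_specializes ht₁) (snd_specializes ht₂) fun a => ?_)
    · exact (isUnit_sp_stalkMap_fst ht₁ _ a).symm.trans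
        ((H _).trans (isUnit_sp_stalkMap_fst ht₂ _ a))
    · exact (isUnit_sp_stalkMap_snd ht₁ _ a).symm.trans
        ((H _).trans (isUnit_sp_stalkMap_snd ht₂ _ a))
  · intro t' h ht'
    have k := mem_box.1 h
    exact isLocAtUnits_sp ht' _ (hW.isLocAtUnits _ (hfW (fst_specializes ht'))
      (map_specializes f (fst_specializes ht'))) (hU.isLocAtUnits _ k.1 _)
      (hV.isLocAtUnits _ k.2 _)

variable (f g) in
theorem isLocallyFiniteTypeFan_obj (hX : isLocallyFiniteTypeFan X) (hY : isLocallyFiniteTypeFan Y)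
    (hS : isLocallyFiniteTypeFan S) : isLocallyFiniteTypeFan (obj f g) :=
  isLocallyFiniteTypeFan_of_isChart fun t => by
    obtain ⟨U, hU⟩ := exists_isChart hX (pt t).1.1
    obtain ⟨V, hV⟩ := exists_isChart hY (pt t).1.2
    obtain ⟨W, hW⟩ := exists_isChart hS (map f (pt t).1.1)
    exact ⟨box U V, isChart hU hV hW⟩

end Pb

/-! ## Flat covers of locally finite type fans are open -/

/-- The image of an open set around `x` contains the whole chart `V` of `map p x`. A point of `V` is
a face of the stalk there, which lifts along the flat local stalk map to a face of the stalk at `x`.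
The corresponding point specializes to `x`, so it lies in the open set. -/
theorem IsFlatCover.isOpenFlatCover {X Y : LMS.{u}} {p : X ⟶ Y} (hp : IsFlatCover p)
    (hX : isLocallyFiniteTypeFan X) (hY : isLocallyFiniteTypeFan Y) : IsOpenFlatCover p := by
  have hfl : ∀ x, IsFlatLocal (stalkMap p x) := fun x =>
    IsFlatHom.isFlatLocal (hp.1 x) fun q => (isUnit_stalkMap_iff p x q).1
  refine ⟨fun O hO => isOpen_iff_forall_mem_open.2 ?_, hp.2, hfl⟩
  rintro _ ⟨x, hx, rfl⟩
  obtain ⟨U, hU⟩ := exists_isChart hX x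
  obtain ⟨V, hV⟩ := exists_isChart hY (map p x)
  refine ⟨V, fun y hy => ?_, V.2, hV.mem⟩
  have hyx := hV.specializes y hy
  obtain ⟨G, hG, HG⟩ := (hfl x).exists_face ((IsUnit.submonoid _).comap (Y.sp hyx))
    (fun {a b} hab => by
      change IsUnit (Y.sp hyx (a * b)) at hab
      rw [map_mul, IsUnit.mul_iff] at hab
      exact hab)
  obtain ⟨x', hx', h, H⟩ := hU.exists_point ⟨G, hG⟩
  have hpx : map p x' ⤳ map p x := map_specializes p h
  refine ⟨x', h.mem_open hO hx, hV.eq_of_iff _ (hpx.mem_open V.2 hV.mem) _ hy hpx hyx fun a => ?_⟩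
  rw [← isUnit_stalkMap_iff p x', stalkMap_sp p h, H]
  exact HG a

/-! ## Faithfully flat homomorphisms are flat and local -/

section FaithfullyFlat

open SpecStalk

/-- Localizing at units changes nothing. -/
theorem SpecStalk.toStalk_bijective {P : CommMonCat.{u}} (F : (Spec P).obj)
    (hF : ∀ a ∈ (face F).toSubmonoid, IsUnit a) : Function.Bijective (toStalk F) := by
  refine ⟨fun a a' w => ?_, fun z => ?_⟩
  · obtain ⟨c, hc, e⟩ := exists_of_toStalk_eq w
    exact (hF c hc).mul_left_cancel e
  · obtain ⟨a, b, hb, e⟩ := exists_mul_eq z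
    obtain ⟨b', e'⟩ := (hF b hb).exists_right_inv
    refine ⟨a * b', ?_⟩
    rw [map_mul, ← e, mul_assoc, ← map_mul, e', map_one, mul_one]

variable {Q P : CommMonCat.{u}} (h : Q ⟶ P)

theorem stalkMap_specMap_toStalk (F : (Spec P).obj) (q : Q) :
    stalkMap (specMap h) F (toStalk _ q) = toStalk F (h.hom q) := by
  have e : pull (specMap h) ⊤ (const q) = const (h.hom q) :=
    Subtype.ext (funext fun G => (locMap_mk h.hom G.1 q 1 (one_mem _)).trans
      (congrArg (Localization.mk _) (Subtype.ext (map_one h.hom))))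
  exact (stalkMap_germ (specMap h) ⊤ F trivial (const q)).trans
    (congrArg ((Spec P).germ ⊤ F trivial) e)

/-- The face of units. -/
def unitFace (P : Type*) [CommMonoid P] : Face P where
  toSubmonoid := IsUnit.submonoid P
  mem_of_mul_mem := IsUnit.mul_iff.1

theorem Face.mem_of_isUnit {P : Type*} [CommMonoid P] (F : Face P) {a : P} (ha : IsUnit a) :
    a ∈ F.toSubmonoid := by
  obtain ⟨b, hb⟩ := ha.exists_right_inv
  exact (F.mem_of_mul_mem (hb.symm ▸ one_mem F.toSubmonoid : a * b ∈ F.toSubmonoid)).1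

variable {h}

/-- Once `h` is known to be local, the stalks at the face of units of `P` and at its preimage are
`P` and `Q` themselves, and `h` is identified with the flat stalk map there. -/
theorem IsFaithfullyFlat.isFlatLocal (H : IsFaithfullyFlat h) : IsFlatLocal h.hom := by
  have hl : ∀ q, IsUnit (h.hom q) → IsUnit q := fun q hq => by
    -- Any face contains all units of `P`, so a face lying over the units of `Q` shows that only
    -- units of `Q` map to units.
    obtain ⟨F, hF⟩ := H.2 (ofFace (unitFace Q))
    have : q ∈ (face (map (specMap h) F)).toSubmonoid := (face F).mem_of_isUnit hq
    change map (specMap h) F = _ at hF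
    rw [hF] at this
    exact this
  let x : (Spec P).obj := ofFace (unitFace P)
  have hx := toStalk_bijective x fun _ ha => ha
  have hy := toStalk_bijective (map (specMap h) x) hl
  have hflat : IsFlatLocal (stalkMap (specMap h) x) :=
    IsFlatHom.isFlatLocal (H.1 x) fun q => (isUnit_stalkMap_iff _ x q).1
  have := (hflat.comp_mulEquiv (MulEquiv.ofBijective _ hy)).mulEquiv_comp
    (MulEquiv.ofBijective _ hx).symm
  convert this using 1
  ext q
  exact (MulEquiv.ofBijective _ hx).eq_symm_apply.2 (stalkMap_specMap_toStalk h x q).symm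

end FaithfullyFlat

/-- A map which equalizes the projections of a kernel pair of `p` equalizes any two maps which
`p` identifies. -/
theorem comp_eq_comp_of_isPullback {C : Type w} [Category.{v} C] {R X Y Z T : C} {p : X ⟶ Y}
    {π₁ π₂ : R ⟶ X} (h : IsPullback π₁ π₂ p p) {f : X ⟶ Z} (hf : π₁ ≫ f = π₂ ≫ f) {a b : T ⟶ X}
    (w : a ≫ p = b ≫ p) : a ≫ f = b ≫ f := by
  have h₁ : a ≫ f = h.lift a b w ≫ π₁ ≫ f := by rw [← Category.assoc, h.lift_fst]
  have h₂ : b ≫ f = h.lift a b w ≫ π₂ ≫ f := by rw [← Category.assoc, h.lift_snd]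
  rw [h₁, h₂, hf]

/-! ## Descent for monoids -/

section Mon

variable {Q P P' : CommMonCat.{u}}

/-- Amalgamated sums are pushouts. -/
theorem isPushout_amalg (h : Q ⟶ P) (k : Q ⟶ P') :
    IsPushout h k (CommMonCat.ofHom (Amalg.inl h.hom k.hom))
      (CommMonCat.ofHom (Amalg.inr h.hom k.hom)) :=
  ⟨⟨CommMonCat.hom_ext (MonoidHom.ext (Amalg.condition h.hom k.hom))⟩, by
    have hs (s : PushoutCocone h k) (q : Q) : s.inl.hom (h.hom q) = s.inr.hom (k.hom q) :=
      congrArg (fun l => l.hom q) s.condition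
    refine ⟨PushoutCocone.IsColimit.mk _
      (fun s => CommMonCat.ofHom (Amalg.lift s.inl.hom s.inr.hom (hs s)))
      (fun s => ?_) (fun s => ?_) fun s l h₁ h₂ => ?_⟩
    · exact CommMonCat.hom_ext (MonoidHom.ext (Amalg.lift_inl _ _ (hs s)))
    · exact CommMonCat.hom_ext (MonoidHom.ext (Amalg.lift_inr _ _ (hs s)))
    · exact CommMonCat.hom_ext (Amalg.hom_ext
        (fun p => (congrArg (fun l => l.hom p) h₁).trans (Amalg.lift_inl _ _ (hs s) p).symm)
        (fun p => (congrArg (fun l => l.hom p) h₂).trans (Amalg.lift_inr _ _ (hs s) p).symm))⟩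

theorem IsFlatLocal.of_isPushout {h : Q ⟶ P} {k : Q ⟶ P'} {R : CommMonCat.{u}} {a : P ⟶ R}
    {b : P' ⟶ R} (H : IsFlatLocal h.hom) (w : IsPushout h k a b) : IsFlatLocal b.hom := by
  let e := (isPushout_amalg h k).isoIsPushout _ _ w
  have := (H.inr k.hom).mulEquiv_comp e.commMonCatIsoToMulEquiv
  convert this using 1
  exact congrArg (fun l => l.hom) ((isPushout_amalg h k).inr_isoIsPushout_hom _ _ w).symm

theorem IsFlatLocal.isEffectiveDescent {k : Q ⟶ P} (H : IsFlatLocal k.hom) :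
    IsEffectiveDescent k.op := by
  refine ⟨inferInstance, fun R π₁ π₂ hR Z f hf => ?_⟩
  have w := (isPushout_amalg k k).op
  -- The kernel pair `R` is arbitrary; its universal property transfers the hypothesis to the
  -- concrete amalgamated sum, where elements can be computed.
  have e : (CommMonCat.ofHom (Amalg.inr k.hom k.hom)).op ≫ f =
      (CommMonCat.ofHom (Amalg.inl k.hom k.hom)).op ≫ f :=
    comp_eq_comp_of_isPullback hR hf w.w
  have e' : ∀ z, ∃ q, k.hom q = f.unop.hom z := fun z =>
    H.exists_preimage (congrArg (fun l => l.unop.hom z) e.symm)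
  choose s hs using e'
  let g : Z.unop →* Q :=
    { toFun := s
      map_one' := H.injective (by rw [hs, map_one, map_one])
      map_mul' := fun a b => H.injective (by rw [hs, map_mul, map_mul, hs, hs]) }
  refine ⟨(CommMonCat.ofHom g).op, ?_, fun g' hg' => ?_⟩
  · exact Quiver.Hom.unop_inj (CommMonCat.hom_ext (MonoidHom.ext hs))
  · refine Quiver.Hom.unop_inj (CommMonCat.hom_ext (MonoidHom.ext fun z => H.injective ?_))
    exact (congrArg (fun l => l.unop.hom z) hg').trans (hs z).symm

/-- Base change in the opposite category is pushout, which preserves `IsFlatLocal`; universality is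
thus reduced to effective descent. -/
theorem IsFlatLocal.isUniversalEffectiveDescent {h : Q ⟶ P} (H : IsFlatLocal h.hom) :
    IsUniversalEffectiveDescent h.op := fun _ _ =>
  ⟨inferInstance, fun _ _ p' w => (H.of_isPushout w.unop.flip).isEffectiveDescent (k := p'.unop)⟩

end Mon

/-! ## Descent for locally finite type fans -/

namespace LFTFan

variable {X Y S : LFTFan.{u}}

/-- The fiber product of locally finite type fans. -/
def pb (f : X ⟶ S) (g : Y ⟶ S) : LFTFan.{u} :=
  ⟨Pb.obj f.hom g.hom, Pb.isLocallyFiniteTypeFan_obj f.hom g.hom X.property Y.property S.property⟩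

/-- The first projection. -/
def fst (f : X ⟶ S) (g : Y ⟶ S) : pb f g ⟶ X := ObjectProperty.homMk (Pb.fst f.hom g.hom)

/-- The second projection. -/
def snd (f : X ⟶ S) (g : Y ⟶ S) : pb f g ⟶ Y := ObjectProperty.homMk (Pb.snd f.hom g.hom)

theorem isPullback (f : X ⟶ S) (g : Y ⟶ S) : IsPullback (fst f g) (snd f g) f g :=
  IsPullback.of_map_of_faithful isLocallyFiniteTypeFan.ι Pb.isPullback

theorem isEffectiveDescent {p : X ⟶ Y} (hp : IsOpenFlatCover p.hom) : IsEffectiveDescent p := by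
  have w := isPullback p p
  refine ⟨w.hasPullback, fun R π₁ π₂ hR Z f hf => ?_⟩
  have e : fst p p ≫ f = snd p p ≫ f := comp_eq_comp_of_isPullback hR hf w.w
  obtain ⟨g, hg⟩ := hp.exists_comp_eq (congrArg (fun l => l.hom) e)
  refine ⟨ObjectProperty.homMk g, ObjectProperty.hom_ext _ hg, fun g' hg' => ?_⟩
  exact ObjectProperty.hom_ext _ (hp.eq_of_comp_eq ((congrArg (fun l => l.hom) hg').trans hg.symm))

end LFTFan

theorem IsOpenFlatCover.iso_comp {X X' Y : LMS.{u}} (e : X' ⟶ X) [IsIso e] {p : X ⟶ Y}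
    (hp : IsOpenFlatCover p) : IsOpenFlatCover (e ≫ p) := by
  have he := IsOpenImm.of_isIso e
  have hs : Function.Surjective (map e) := fun x =>
    ⟨map (inv e) x, congrArg (fun k => map k x) (IsIso.inv_hom_id e)⟩
  refine ⟨hp.isOpenMap.comp he.isOpenEmbedding.isOpenMap, hp.surjective.comp hs, fun x => ?_⟩
  have := (hp.isFlatLocal (map e x)).mulEquiv_comp (MulEquiv.ofBijective _ (he.bijective x))
  have h : stalkMap (e ≫ p) x = (stalkMap e x).comp (stalkMap p (map e x)) :=
    MonoidHom.ext fun a => stalkMap_comp e p x a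
  rw [h]
  exact this

/-- Openness is derived from finite type once, for `p`; then `IsOpenFlatCover` passes to the
concrete base change and, through an isomorphism, to any other pullback `p'`. -/
theorem LFTFan.isUniversalEffectiveDescent {X Y : LFTFan.{u}} {p : X ⟶ Y}
    (hp : IsFlatCover p.hom) : IsUniversalEffectiveDescent p := fun Y' g => by
  refine ⟨(isPullback p g).hasPullback, fun X' g' p' w => isEffectiveDescent ?_⟩
  let e := w.isoIsPullback _ _ (isPullback p g)
  have he : IsIso (isLocallyFiniteTypeFan.ι.map e.hom) := inferInstance
  have := (((hp.isOpenFlatCover X.property Y.property).snd g.hom).iso_comp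
    (isLocallyFiniteTypeFan.ι.map e.hom))
  rwa [← show _ = p'.hom from
    congrArg (fun l => l.hom) (w.isoIsPullback_hom_snd _ _ (isPullback p g))]

end Fans

end

theorem mainTheorem3 :
    (∀ (Q P : CommMonCat.{u}) (h : Q ⟶ P),
      Fans.IsFaithfullyFlat h → Fans.IsUniversalEffectiveDescent h.op) ∧
    (∀ (X Y : Fans.LFTFan.{u}) (p : X ⟶ Y),
      Fans.IsFlatCover p.hom → Fans.IsUniversalEffectiveDescent p) :=
  ⟨fun _ _ _ H => H.isFlatLocal.isUniversalEffectiveDescent,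
    fun _ _ _ => Fans.LFTFan.isUniversalEffectiveDescent⟩
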